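/- Notation. For $K\subset\mathbb N$ let $\delta_+(K)=\limsup_{n\to\infty}|K\cap\{1,\dots,n\}|/n$. For a real sequence $(y_n)_{n\ge1}$, $L\in\mathbb R$ and $A\subset\mathbb R$, the indices of convergence are $$i(y_n;L)=1-\sup_{\varepsilon>0}\delta_+(\{n: y_n\le L-\varepsilon\text{ or }y_n\ge L+\varepsilon\}),\qquad i(y_n;A)=1-\sup_{\varepsilon>0}\delta_+(\{n: y_n\notin A+{]-\varepsilon,\varepsilon[}\}).$$ For $f:[-1,1]\to\mathbb R$ and $n\ge1$ let $L_nf$ be the Lagrange interpolation operator at the Chebyshev nodes $x_{n,k}=\cos\frac{(2k-1)\pi}{2n}$, that is $$L_nf(x)=\sum_{k=1}^n f(x_{n,k})\prod_{j\ne k}\frac{x-x_{n,j}}{x_{n,k}-x_{n,j}} .$$ For $0<t<1$ let $$g(t)=\frac{\sin(\pi t)}{\pi}\sum_{n=0}^{\infty}\frac{(-1)^n}{n+t}.$$ Let $C_\omega$ be the set of all $F\in C([-1,1])$ whose modulus of continuity satisfies $\omega(F,\delta)=o(|\log\delta|^{-1})$ as $\delta\to0^+$, and let $H$ be the linear span of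 the functions $h_{x_0,d}$ on $[-1,1]$ with $x_0\in\,]-1,1[$ and $d\in\mathbb R$, where $h_{x_0,d}(x)$ equals $0$ for $x<x_0$, $d$ for $x=x_0$ and $1$ for $x>x_0$. A set $A\subset\mathbb R$ is called Peano–Jordan measurable if its boundary has Lebesgue measure zero; $|\cdot|$ denotes the Peano–Jordan (Lebesgue) measure. Theorem. Let $f$ be of bounded variation on $[-1,1]$, or alternatively $f\in C_\omega+H$, and suppose that the set of points of discontinuity of $f$ in $[-1,1]$ is a finite set $\{x_1,\dots,x_N\}\subset\,]-1,1[$ (with $x_1,\dots,x_N$ distinct), the one-sided limits $f(x_i-0)$ and $f(x_i+0)$ being finite. Let $\theta_i\in\,]0,\pi[$ with $x_i=\cos\theta_i$, let $d_i=f(x_i)$, and for $0<t<1$ put $$g_i(t)=f(x_i-0)+(f(x_i+0)-f(x_i-0))\,g(t).$$ Then $(L_nf)_{n\ge1}$ converges to $f$ uniformly on every compact subset of $]-1,1[\,\setminus\{x_1,\dots,x_N\}$. Moreover, for every $i$ with $f(x_i-0)\ne f(x_i+0)$, the following hold. (i) Suppose $\theta_i/\pi=p/q$ with $p,q\in\mathbb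 N$, $q\ne0$, $\gcd(p,q)=1$. If $q$ is odd, then $i\big(L_nf(x_i);g_i(\tfrac{2m+1}{2q})\big)=\tfrac1q$ for $m=0,\dots,q-1$. If $q$ is even, then $i\big(L_nf(x_i);g_i(\tfrac mq)\big)=\tfrac1q$ for every $m\in\{1,\dots,q-1\}$ with $g_i(\tfrac mq)\ne d_i$. In addition, $i(L_nf(x_i);d_i)=\tfrac1q$ if $d_i\ne g_i(\tfrac mq)$ for all $m\in\{1,\dots,q-1\}$, and $i(L_nf(x_i);d_i)=\tfrac2q$ if $d_i=g_i(\tfrac mq)$ for some $m\in\{1,\dots,q-1\}$. (ii) If $\theta_i/\pi$ is irrational and $A\subset\mathbb R$ is Peano–Jordan measurable, then $g_i^{-1}(A)=\{t\in\,]0,1[\;:\;g_i(t)\in A\}$ is Peano–Jordan measurable and $$i(L_nf(x_i);A)=|g_i^{-1}(A)|.$$ -/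

import Mathlib

open Set Filter Topology MeasureTheory
open scoped Pointwise

noncomputable section

namespace LagrangeIndex

/-! ### Density and index of convergence -/

/-- The upper density `limsup |K ∩ {1,…,n}| / n` of a set of natural numbers. -/
def upperDensity (K : Set ℕ) : ℝ :=
  limsup (fun n : ℕ => ((K ∩ Set.Icc 1 n).ncard : ℝ) / n) atTop

/-- The index of convergence of a real sequence `(u n)`, `n ≥ 1`, to the real number `L`.
(The value `u 0` is irrelevant, since `upperDensity` only looks at indices `≥ 1`.) -/
def index (u : ℕ → ℝ) (L : ℝ) : ℝ :=
  1 - ⨆ ε : {ε : ℝ // 0 < ε},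
    upperDensity {n | u n ∈ Set.Iic (L - (ε : ℝ)) ∪ Set.Ici (L + (ε : ℝ))}

/-- The index of convergence of a real sequence relatively to a set `A` of real numbers. -/
def indexSet (u : ℕ → ℝ) (A : Set ℝ) : ℝ :=
  1 - ⨆ ε : {ε : ℝ // 0 < ε},
    upperDensity {n | u n ∉ A + Set.Ioo (-(ε : ℝ)) (ε : ℝ)}

/-- Peano–Jordan measurability of a subset of the line: the boundary is a null set. For bounded
sets this is the usual notion, and the Peano–Jordan measure is then the Lebesgue measure. An
unbounded set satisfies it iff its intersections with all bounded intervals do. -/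
def IsPeanoJordanMeasurable (A : Set ℝ) : Prop :=
  volume (frontier A) = 0

/-! ### Lagrange operators at the Chebyshev nodes -/

/-- The Chebyshev node `x_{n,k} = cos ((2k-1)π / (2n))`, for `1 ≤ k ≤ n`. -/
def node (n k : ℕ) : ℝ :=
  Real.cos ((2 * (k : ℝ) - 1) * Real.pi / (2 * (n : ℝ)))

/-- The fundamental polynomial `ℓ_{n,k}`. -/
def fundamental (n k : ℕ) (x : ℝ) : ℝ :=
  ∏ i ∈ (Finset.Icc 1 n).erase k, (x - node n i) / (node n k - node n i)

/-- The `n`-th Lagrange operator at the Chebyshev nodes. -/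
def lagrangeOp (n : ℕ) (f : ℝ → ℝ) (x : ℝ) : ℝ :=
  ∑ k ∈ Finset.Icc 1 n, fundamental n k x * f (node n k)

/-! ### The classes of functions

A function on `[-1,1]` is given by a function on `ℝ` of which only the values on `[-1,1]` matter. -/

/-- The modulus of continuity on `[-1,1]`. -/
def modulus (F : ℝ → ℝ) (δ : ℝ) : ℝ :=
  sSup {r | ∃ x ∈ Set.Icc (-1 : ℝ) 1, ∃ y ∈ Set.Icc (-1 : ℝ) 1, |x - y| ≤ δ ∧ r = |F x - F y|}

/-- Continuity on `[-1,1]` together with the Dini–Lipschitz condition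
`ω(F, δ) = o(|log δ|⁻¹)` as `δ → 0+`. -/
def DiniLipschitz (F : ℝ → ℝ) : Prop :=
  ContinuousOn F (Set.Icc (-1) 1) ∧
    modulus F =o[𝓝[>] (0 : ℝ)] fun δ => |Real.log δ|⁻¹

/-- The function equal to `0` to the left of `x₀`, to `d` at `x₀` and to `1` to the right. -/
def stepFun (x₀ d : ℝ) (x : ℝ) : ℝ :=
  if x < x₀ then 0 else if x = x₀ then d else 1

/-- The linear space generated by the step functions with step in `]-1,1[`. -/
def stepSpace : Submodule ℝ (ℝ → ℝ) :=
  Submodule.span ℝ {h | ∃ x₀ ∈ Set.Ioo (-1 : ℝ) 1, ∃ d : ℝ, h = stepFun x₀ d}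

/-- On `[-1,1]`, `f` is the sum of a Dini–Lipschitz function and a combination of steps. -/
def DiniLipschitzPlusSteps (f : ℝ → ℝ) : Prop :=
  ∃ F : ℝ → ℝ, DiniLipschitz F ∧ ∃ h ∈ stepSpace, ∀ x ∈ Set.Icc (-1 : ℝ) 1, f x = F x + h x

/-! ### The limit function -/

/-- The Lerch zeta function `J(s,a) = ∑_{n ≥ 0} (-1)^n / (n+a)^s`, for real `s > 0` and `a > 0`.
The series is summed in the order of the indices (at `s = 1` it converges only conditionally). -/
def lerchJ (s a : ℝ) : ℝ :=
  ∑'[SummationFilter.conditional ℕ] n : ℕ, (-1 : ℝ) ^ n / ((n : ℝ) + a) ^ s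

/-- The series defining `J(s,a)` converges. -/
theorem summable_lerchJ {s a : ℝ} (hs : 0 < s) (ha : 0 < a) :
    Summable (fun n : ℕ => (-1 : ℝ) ^ n / ((n : ℝ) + a) ^ s)
      (SummationFilter.conditional ℕ) := by
  have hanti : Antitone fun n : ℕ => (((n : ℝ) + a) ^ s)⁻¹ := by
    intro m n hmn
    have h0 : (0 : ℝ) ≤ m := m.cast_nonneg
    have h1 : (m : ℝ) ≤ n := by exact_mod_cast hmn
    have h2 : 0 < ((m : ℝ) + a) ^ s := Real.rpow_pos_of_pos (by linarith) s
    exact inv_anti₀ h2 (Real.rpow_le_rpow (by linarith) (by linarith) hs.le)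
  have hzero : Tendsto (fun n : ℕ => (((n : ℝ) + a) ^ s)⁻¹) atTop (𝓝 0) :=
    ((tendsto_rpow_atTop hs).comp
      (tendsto_atTop_add_const_right _ a tendsto_natCast_atTop_atTop)).inv_tendsto_atTop
  obtain ⟨l, hl⟩ := hanti.tendsto_alternating_series_of_tendsto_zero hzero
  refine ⟨l, ?_⟩
  rw [HasSum, SummationFilter.conditional_filter_eq_map_range, tendsto_map'_iff]
  simpa [Function.comp_def, div_eq_mul_inv] using hl

/-- The function `g(t) = sin(πt)/π · J(1,t)` on `]0,1[`. -/
def gFun (t : ℝ) : ℝ :=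
  Real.sin (Real.pi * t) / Real.pi * lerchJ 1 t

/-- The function `a + (b - a) g` on `]0,1[`, where `a` and `b` stand for the left and the right
limit at a point of discontinuity. -/
def gJump (a b t : ℝ) : ℝ :=
  a + (b - a) * gFun t

end LagrangeIndex

end

/-! Let `angle n k` be the angles of the nodes. Since `T_n` vanishes at the nodes, the fundamental
polynomial at `cos θ` is `(-1)^(k+1) cos(nθ) sin(angle n k) / (n (cos θ - cos(angle n k)))`. In
units of the node spacing `π/n`, the position of `θ` is `nθ/π + 1/2`, with fractional part `t_n =
posFract n θ`. Hence `|cos(nθ)| = sin(π t_n)`, and the nodes on the two sides of `θ` lie at angular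
distances `π/n (t_n + j)` and `π/n (j + 1 - t_n)`. On each side the values of the fundamental
polynomials alternate in sign, and their absolute values (`weightLeft`, `weightRight`) decrease in
`j` and are at most `2/(j+1)`.

Uniform convergence follows by Abel summation. Both classes of functions are `Admissible`: along `j`
consecutive nodes the variation is at most `M + j w_n` with `w_n log n → 0`. The `J` nearest nodes
on each side are handled by continuity; the others contribute `O(M/J) + O(w_n log n)`
(`NodeVariationBound.abs_lagrangeOp_sub_le`).

At a jump, subtracting a suitable multiple of a step function leaves an admissible function
continuous at the point, so only the step matters. Its interpolant is the alternating sum of the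
left weights, asymptotic to the series of `g(t_n)` because `(b - θ) kernel θ b → 1`. If `t_n = 0`,
the point is itself a node and the value is exact. Therefore `L_n f(x_i)` is asymptotic to
`jumpValue` (`Admissible.tendsto_lagrangeOp_sub_jumpValue`), and the indices are frequencies of
`t_n`.

If `θ/π = p/q`, then `t_n` runs through `q` values, each on one residue class of `n` modulo `q`, and
strict monotonicity of `g` keeps the corresponding limits apart. If `θ/π` is irrational, Weyl's
theorem gives the frequencies of Peano–Jordan sets. A quantitative monotonicity of `g`
(`gFun_sub_ge`), resting on `g(t) + g(1 - t) = 1`, shows that preimages of null sets are null, which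
carries Peano–Jordan measurability back to `]0,1[`. -/

noncomputable section

namespace LagrangeIndex

/-! ### Chebyshev nodes and their fundamental polynomials -/

/-- The angle of the Chebyshev node `node n k`. -/
def angle (n k : ℕ) : ℝ :=
  (2 * (k : ℝ) - 1) * Real.pi / (2 * (n : ℝ))

theorem node_eq_cos_angle (n k : ℕ) : node n k = Real.cos (angle n k) := rfl

theorem angle_pos {n k : ℕ} (hk : k ∈ Finset.Icc 1 n) : 0 < angle n k := by
  rw [Finset.mem_Icc] at hk
  have h1 : (1 : ℝ) ≤ k := by exact_mod_cast hk.1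
  have hn : (0 : ℝ) < n := by exact_mod_cast (by omega : 0 < n)
  unfold angle
  have := Real.pi_pos
  have : (0 : ℝ) < 2 * k - 1 := by linarith
  positivity

theorem angle_lt_pi {n k : ℕ} (hk : k ∈ Finset.Icc 1 n) : angle n k < Real.pi := by
  rw [Finset.mem_Icc] at hk
  have h1 : (k : ℝ) ≤ n := by exact_mod_cast hk.2
  have hn : (0 : ℝ) < n := by exact_mod_cast (by omega : 0 < n)
  unfold angle
  rw [div_lt_iff₀ (by positivity)]
  nlinarith [Real.pi_pos]

theorem angle_strictMono {n : ℕ} (hn : 0 < n) : StrictMono (angle n) := by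
  intro i j hij
  have h1 : (i : ℝ) < j := by exact_mod_cast hij
  have hn : (0 : ℝ) < n := by exact_mod_cast hn
  have := Real.pi_pos
  unfold angle
  gcongr

theorem node_lt_node {n i j : ℕ} (hi : i ∈ Finset.Icc 1 n) (hj : j ∈ Finset.Icc 1 n)
    (hij : i < j) : node n j < node n i := by
  have hn : 0 < n := by rw [Finset.mem_Icc] at hi; omega
  exact Real.cos_lt_cos_of_nonneg_of_le_pi (angle_pos hi).le (angle_lt_pi hj).le
    (angle_strictMono hn hij)

theorem node_injOn (n : ℕ) : Set.InjOn (node n) (Finset.Icc 1 n : Finset ℕ) := by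
  intro i hi j hj h
  rcases lt_trichotomy i j with hij | hij | hij
  · exact absurd h (node_lt_node hi hj hij).ne'
  · exact hij
  · exact absurd h (node_lt_node hj hi hij).ne

theorem node_mem_Icc (n k : ℕ) : node n k ∈ Set.Icc (-1 : ℝ) 1 :=
  ⟨Real.neg_one_le_cos _, Real.cos_le_one _⟩

theorem fundamental_eq_eval_basis (n k : ℕ) (x : ℝ) :
    fundamental n k x = (Lagrange.basis (Finset.Icc 1 n) (node n) k).eval x := by
  unfold fundamental Lagrange.basis
  rw [Polynomial.eval_prod]
  refine Finset.prod_congr rfl fun i _ => ?_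
  simp [Lagrange.basisDivisor, div_eq_inv_mul]

theorem sum_fundamental {n : ℕ} (hn : 0 < n) (x : ℝ) :
    ∑ k ∈ Finset.Icc 1 n, fundamental n k x = 1 := by
  simp_rw [fundamental_eq_eval_basis]
  rw [← Polynomial.eval_finsetSum, Lagrange.sum_basis (node_injOn n) ⟨1, by simp; omega⟩,
    Polynomial.eval_one]

theorem fundamental_node_self {n k : ℕ} (hk : k ∈ Finset.Icc 1 n) :
    fundamental n k (node n k) = 1 := by
  rw [fundamental_eq_eval_basis, Lagrange.eval_basis_self (node_injOn n) hk]

theorem fundamental_node_of_ne {n k j : ℕ} (hj : j ∈ Finset.Icc 1 n) (hkj : k ≠ j) :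
    fundamental n k (node n j) = 0 := by
  rw [fundamental_eq_eval_basis, Lagrange.eval_basis_of_ne hkj hj]

theorem lagrangeOp_node {n k : ℕ} (hk : k ∈ Finset.Icc 1 n) (f : ℝ → ℝ) :
    lagrangeOp n f (node n k) = f (node n k) := by
  unfold lagrangeOp
  rw [Finset.sum_eq_single_of_mem k hk, fundamental_node_self hk, one_mul]
  intro j _ hjk
  rw [fundamental_node_of_ne hk hjk, zero_mul]

theorem lagrangeOp_sub_eq_sum {n : ℕ} (hn : 0 < n) (f : ℝ → ℝ) (x c : ℝ) :
    lagrangeOp n f x - c = ∑ k ∈ Finset.Icc 1 n, fundamental n k x * (f (node n k) - c) := by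
  simp_rw [mul_sub, Finset.sum_sub_distrib, ← Finset.sum_mul]
  rw [sum_fundamental hn, one_mul, lagrangeOp]

theorem lagrangeOp_add (n : ℕ) (f g : ℝ → ℝ) (x : ℝ) :
    lagrangeOp n (f + g) x = lagrangeOp n f x + lagrangeOp n g x := by
  simp [lagrangeOp, mul_add, Finset.sum_add_distrib]

theorem lagrangeOp_smul (n : ℕ) (c : ℝ) (f : ℝ → ℝ) (x : ℝ) :
    lagrangeOp n (c • f) x = c * lagrangeOp n f x := by
  simp [lagrangeOp, Finset.mul_sum, mul_left_comm]

theorem nat_mul_angle {n : ℕ} (hn : 0 < n) (k : ℕ) :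
    (n : ℝ) * angle n k = k * Real.pi - Real.pi / 2 := by
  have hn : (n : ℝ) ≠ 0 := by exact_mod_cast hn.ne'
  unfold angle
  field_simp

theorem cos_nat_mul_angle {n : ℕ} (hn : 0 < n) (k : ℕ) : Real.cos (n * angle n k) = 0 := by
  rw [nat_mul_angle hn, Real.cos_sub_pi_div_two, Real.sin_nat_mul_pi]

theorem sin_nat_mul_angle {n : ℕ} (hn : 0 < n) (k : ℕ) :
    Real.sin (n * angle n k) = (-1) ^ (k + 1) := by
  rw [nat_mul_angle hn, Real.sin_sub_pi_div_two, Real.cos_nat_mul_pi, pow_succ]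
  ring

/-- The kernel of Lagrange interpolation at the Chebyshev nodes, in angular variables. -/
def kernel (a b : ℝ) : ℝ :=
  Real.sin b / (Real.cos a - Real.cos b)

-- The quotient `Q` of `T_n` by `X - node n k` has degree below `n`, so it equals its own
-- interpolant at the nodes. It vanishes at every node but the `k`-th, where it takes the value
-- `T_n'(node n k)`.
open Polynomial in
theorem eval_T_eq_mul_fundamental {n k : ℕ} (hk : k ∈ Finset.Icc 1 n) (x : ℝ) :
    (Chebyshev.T ℝ n).eval x =
      (x - node n k) * ((derivative (Chebyshev.T ℝ n)).eval (node n k) * fundamental n k x) := by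
  have hn : 0 < n := by rw [Finset.mem_Icc] at hk; omega
  have hroot : ∀ j, (Chebyshev.T ℝ n).eval (node n j) = 0 := by
    intro j
    rw [node_eq_cos_angle, Chebyshev.T_real_cos, Int.cast_natCast, cos_nat_mul_angle hn]
  obtain ⟨Q, hQ⟩ := dvd_iff_isRoot.mpr (hroot k)
  have hT0 : Chebyshev.T ℝ n ≠ 0 := by
    intro h
    have := Chebyshev.T_real_cos 0 n
    rw [h] at this
    simp at this
  have hQ0 : Q ≠ 0 := by
    rintro rfl
    exact hT0 (by simpa using hQ)
  have hdeg : Q.degree < ((Finset.Icc 1 n).card : ℕ) := by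
    rw [Nat.card_Icc, Nat.add_sub_cancel, ← natDegree_lt_iff_degree_lt hQ0]
    have h1 : (Chebyshev.T ℝ n).natDegree = n := by
      simp
    rw [hQ, natDegree_mul (X_sub_C_ne_zero _) hQ0, natDegree_X_sub_C] at h1
    omega
  have hder : (derivative (Chebyshev.T ℝ n)).eval (node n k) = Q.eval (node n k) := by
    rw [hQ, derivative_mul]
    simp
  have hval : ∀ i ∈ Finset.Icc 1 n, Q.eval (node n i) =
      if i = k then (derivative (Chebyshev.T ℝ n)).eval (node n k) else 0 := by
    intro i hi
    split_ifs with h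
    · rw [h, hder]
    · have h1 := hroot i
      rw [hQ, eval_mul, eval_sub, eval_X, eval_C, mul_eq_zero, sub_eq_zero] at h1
      exact h1.resolve_left fun h2 => h (node_injOn n hi hk h2)
  have hint := Lagrange.eq_interpolate_of_eval_eq _ (node_injOn n) hdeg hval
  rw [fundamental_eq_eval_basis, hQ, eval_mul, ← hQ, eval_sub, eval_X, eval_C]
  congr 1
  conv_lhs => rw [hint]
  rw [Lagrange.interpolate_apply, eval_finsetSum, Finset.sum_eq_single_of_mem k hk]
  · simp
  · intro j _ hj
    simp [hj]

-- `T_n' = n U_(n-1)` and `U_(n-1)(cos a) sin a = sin(na)`, which is `±1` at a node.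
open Polynomial in
theorem derivative_T_node_mul_sin {n k : ℕ} (hn : 0 < n) :
    (derivative (Chebyshev.T ℝ n)).eval (node n k) * Real.sin (angle n k) =
      n * (-1) ^ (k + 1) := by
  rw [Chebyshev.T_derivative_eq_U, eval_mul, mul_assoc, node_eq_cos_angle, Chebyshev.U_real_cos]
  simp [sin_nat_mul_angle hn]

theorem fundamental_cos {n k : ℕ} (hk : k ∈ Finset.Icc 1 n) {θ : ℝ}
    (hθ : Real.cos θ ≠ node n k) :
    fundamental n k (Real.cos θ) =
      (-1) ^ (k + 1) * (Real.cos (n * θ) * (kernel θ (angle n k) / n)) := by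
  have hn : 0 < n := by rw [Finset.mem_Icc] at hk; omega
  have hn' : (n : ℝ) ≠ 0 := by exact_mod_cast hn.ne'
  have h1 := eval_T_eq_mul_fundamental hk (Real.cos θ)
  have h2 := derivative_T_node_mul_sin (k := k) hn
  rw [Polynomial.Chebyshev.T_real_cos, Int.cast_natCast] at h1
  have h3 : Real.sin (angle n k) ≠ 0 :=
    (Real.sin_pos_of_pos_of_lt_pi (angle_pos hk) (angle_lt_pi hk)).ne'
  have h4 : Real.cos θ - Real.cos (angle n k) ≠ 0 := sub_ne_zero.mpr hθ
  have h5 : ((-1 : ℝ) ^ (k + 1)) * (-1) ^ (k + 1) = 1 := by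
    rw [← mul_pow]; simp
  unfold kernel
  rw [h1]
  rw [node_eq_cos_angle] at *
  field_simp
  calc _ = fundamental n k (Real.cos θ) * n * ((-1 : ℝ) ^ (k + 1) * (-1) ^ (k + 1)) := by
        rw [h5]; ring
    _ = (-1) ^ (k + 1) * fundamental n k (Real.cos θ) * (n * (-1) ^ (k + 1)) := by ring
    _ = _ := by rw [← h2]; ring

/-! ### Numbering the nodes from a given point -/

/-- The position of `θ` with respect to the angles of the `n`-th row of nodes: `θ` is the angle
of the node of index `pos n θ`. -/
def pos (n : ℕ) (θ : ℝ) : ℝ :=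
  n * θ / Real.pi + 1 / 2

/-- The number of angles of the `n`-th row that do not exceed `θ`. -/
def posFloor (n : ℕ) (θ : ℝ) : ℕ :=
  ⌊pos n θ⌋₊

/-- The fractional part of the position. -/
def posFract (n : ℕ) (θ : ℝ) : ℝ :=
  Int.fract (pos n θ)

theorem posFract_nonneg (n : ℕ) (θ : ℝ) : 0 ≤ posFract n θ := Int.fract_nonneg _

theorem posFract_lt_one (n : ℕ) (θ : ℝ) : posFract n θ < 1 := Int.fract_lt_one _

theorem pos_eq_add {n : ℕ} {θ : ℝ} (hθ : 0 ≤ θ) : pos n θ = posFloor n θ + posFract n θ := by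
  have h : 0 ≤ pos n θ := by
    unfold pos
    have := Real.pi_pos
    positivity
  rw [posFloor, posFract, natCast_floor_eq_intCast_floor h, Int.floor_add_fract]

theorem posFloor_le {n : ℕ} {θ : ℝ} (hθ : 0 ≤ θ) (hθ' : θ ≤ Real.pi) : posFloor n θ ≤ n := by
  have h1 : (posFloor n θ : ℝ) ≤ n + 1 / 2 := by
    have h2 : pos n θ ≤ n + 1 / 2 := by
      unfold pos
      gcongr
      rw [div_le_iff₀ Real.pi_pos]
      gcongr
    linarith [pos_eq_add (n := n) hθ, posFract_nonneg n θ]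
  by_contra! h
  have : (n : ℝ) + 1 ≤ posFloor n θ := by exact_mod_cast h
  linarith

theorem angle_sub {n : ℕ} (hn : 0 < n) (k : ℕ) {θ : ℝ} :
    angle n k - θ = Real.pi / n * (k - pos n θ) := by
  have hn : (n : ℝ) ≠ 0 := by exact_mod_cast hn.ne'
  have := Real.pi_pos.ne'
  unfold angle pos
  field_simp
  ring

/-- By definition of `pos`, `nθ = π (pos n θ - 1/2)`: the integer part gives the sign, and the shift
by `π/2` turns the cosine into a sine. -/
theorem cos_nat_mul {n : ℕ} {θ : ℝ} (hθ : 0 ≤ θ) :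
    Real.cos (n * θ) = (-1) ^ posFloor n θ * Real.sin (Real.pi * posFract n θ) := by
  have hpi := Real.pi_pos.ne'
  have h : (n : ℝ) * θ = Real.pi * posFract n θ + posFloor n θ * Real.pi - Real.pi / 2 := by
    have h1 := pos_eq_add (n := n) hθ
    have h2 : (n : ℝ) * θ = Real.pi * (pos n θ - 1 / 2) := by
      unfold pos
      field_simp
      ring
    rw [h2, h1]
    ring
  rw [h, Real.cos_sub_pi_div_two, Real.sin_add_nat_mul_pi]

theorem eq_node_of_posFract_eq_zero {n : ℕ} (hn : 0 < n) {θ : ℝ} (hθ : 0 < θ) (hθ' : θ < Real.pi)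
    (h : posFract n θ = 0) :
    posFloor n θ ∈ Finset.Icc 1 n ∧ Real.cos θ = node n (posFloor n θ) := by
  have h1 := pos_eq_add (n := n) hθ.le
  rw [h, add_zero] at h1
  have h2 := angle_sub hn (posFloor n θ) (θ := θ)
  rw [h1, sub_self, mul_zero, sub_eq_zero] at h2
  refine ⟨Finset.mem_Icc.mpr ⟨?_, posFloor_le hθ.le hθ'.le⟩, by rw [node_eq_cos_angle, h2]⟩
  -- Index `0` is excluded because `pos n θ ≥ 1/2`, so a vanishing fractional part forces a positive
  -- integer part.
  rw [Nat.one_le_iff_ne_zero]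
  intro h0
  rw [h0] at h1
  have : 0 < pos n θ := by
    unfold pos
    have := Real.pi_pos
    positivity
  simp at h1
  linarith

/-- The angle of the `j`-th node to the left of `θ`. -/
theorem sub_angle_left {n : ℕ} (hn : 0 < n) {θ : ℝ} (hθ : 0 ≤ θ) {j : ℕ}
    (hj : j < posFloor n θ) :
    θ - angle n (posFloor n θ - j) = Real.pi / n * (posFract n θ + j) := by
  have h := angle_sub hn (posFloor n θ - j) (θ := θ)
  rw [pos_eq_add hθ, Nat.cast_sub hj.le] at h
  linarith

/-- The angle of the `j`-th node to the right of `θ`. -/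
theorem angle_right_sub {n : ℕ} (hn : 0 < n) {θ : ℝ} (hθ : 0 ≤ θ) (j : ℕ) :
    angle n (posFloor n θ + 1 + j) - θ = Real.pi / n * (j + (1 - posFract n θ)) := by
  have h := angle_sub hn (posFloor n θ + 1 + j) (θ := θ)
  rw [pos_eq_add hθ] at h
  push_cast at h
  rw [h]
  ring

/-- The sign `(-1)^(posFloor n θ)` of `cos(nθ)` cancels against the parity of the node index, so the
sign depends only on the rank `j` counted from `θ`. The kernel is negative on this side, whence the
minus. -/
theorem fundamental_left {n : ℕ} (hn : 0 < n) {θ : ℝ} (hθ : 0 < θ) (hθ' : θ < Real.pi)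
    (ht : posFract n θ ≠ 0) {j : ℕ} (hj : j < posFloor n θ) :
    fundamental n (posFloor n θ - j) (Real.cos θ) =
      (-1) ^ j * (Real.sin (Real.pi * posFract n θ) *
        (-kernel θ (angle n (posFloor n θ - j)) / n)) := by
  have hk : posFloor n θ - j ∈ Finset.Icc 1 n := by
    have := posFloor_le (n := n) hθ.le hθ'.le
    rw [Finset.mem_Icc]; omega
  have h0 : 0 < posFract n θ := (posFract_nonneg n θ).lt_of_ne' ht
  have h1 := sub_angle_left hn hθ.le hj
  have h2 : angle n (posFloor n θ - j) < θ := by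
    have : 0 < Real.pi / n * (posFract n θ + j) := by
      have := Real.pi_pos
      positivity
    linarith
  rw [fundamental_cos hk, cos_nat_mul hθ.le]
  · have h3 : (-1 : ℝ) ^ (posFloor n θ - j + 1) * (-1) ^ posFloor n θ = - (-1) ^ j := by
      obtain ⟨i, hi⟩ : ∃ i, posFloor n θ = j + i := ⟨posFloor n θ - j, by omega⟩
      rw [hi, Nat.add_sub_cancel_left, ← pow_add, show i + 1 + (j + i) = j + 1 + 2 * i by ring,
        pow_add, pow_mul]
      simp [pow_succ]
    rw [← neg_eq_iff_eq_neg] at h3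
    rw [← h3]
    ring
  · exact (Real.cos_lt_cos_of_nonneg_of_le_pi (angle_pos hk).le hθ'.le h2).ne

theorem lt_angle_right {n : ℕ} (hn : 0 < n) {θ : ℝ} (hθ : 0 ≤ θ) (j : ℕ) :
    θ < angle n (posFloor n θ + 1 + j) := by
  have h1 := angle_right_sub hn hθ j
  have : 0 < Real.pi / n * (j + (1 - posFract n θ)) := by
    have := Real.pi_pos
    have := posFract_lt_one n θ
    have : 0 < 1 - posFract n θ := by linarith
    positivity
  linarith

theorem fundamental_right {n : ℕ} (hn : 0 < n) {θ : ℝ} (hθ : 0 < θ)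
    {j : ℕ} (hj : j < n - posFloor n θ) :
    fundamental n (posFloor n θ + 1 + j) (Real.cos θ) =
      (-1) ^ j * (Real.sin (Real.pi * posFract n θ) *
        (kernel θ (angle n (posFloor n θ + 1 + j)) / n)) := by
  have hk : posFloor n θ + 1 + j ∈ Finset.Icc 1 n := by
    rw [Finset.mem_Icc]; omega
  rw [fundamental_cos hk, cos_nat_mul hθ.le]
  · have h3 : (-1 : ℝ) ^ (posFloor n θ + 1 + j + 1) * (-1) ^ posFloor n θ = (-1) ^ j := by
      rw [← pow_add, show posFloor n θ + 1 + j + 1 + posFloor n θ = j + 2 * (posFloor n θ + 1) by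
        ring, pow_add, pow_mul]
      simp
    rw [← h3]
    ring
  · exact (Real.cos_lt_cos_of_nonneg_of_le_pi hθ.le (angle_lt_pi hk).le
      (lt_angle_right hn hθ.le j)).ne'

/-- A sum over the nodes is split at `θ`. -/
theorem sum_nodes_split {n m : ℕ} (h : m ≤ n) (F : ℕ → ℝ) :
    ∑ k ∈ Finset.Icc 1 n, F k =
      ∑ j ∈ Finset.range m, F (m - j) + ∑ j ∈ Finset.range (n - m), F (m + 1 + j) := by
  have h1 : ∑ k ∈ Finset.Icc 1 n, F k = ∑ i ∈ Finset.range n, F (1 + i) := by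
    rw [← Finset.Ico_succ_right_eq_Icc, Finset.sum_Ico_eq_sum_range]
    rfl
  obtain ⟨r, rfl⟩ := Nat.exists_eq_add_of_le h
  rw [h1, Finset.sum_range_add, Nat.add_sub_cancel_left]
  congr 1
  · rw [← Finset.sum_range_reflect]
    refine Finset.sum_congr rfl fun i hi => ?_
    rw [Finset.mem_range] at hi
    congr 1; omega
  · refine Finset.sum_congr rfl fun i _ => by congr 1; ring

/-! ### Alternating sums -/

/-- Adding the sum to its shifted copy pairs each term with its neighbour of opposite sign: only
differences and the two end terms remain. -/
theorem two_mul_alternating_sum (u : ℕ → ℝ) (k : ℕ) :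
    2 * ∑ i ∈ Finset.range (k + 1), (-1) ^ i * u i =
      u 0 + (-1) ^ k * u k - ∑ i ∈ Finset.range k, (-1) ^ i * (u (i + 1) - u i) := by
  induction k with
  | zero => simp; ring
  | succ k ih =>
    rw [Finset.sum_range_succ, mul_add, ih, Finset.sum_range_succ _ k, pow_succ]
    ring

/-- An alternating sum is controlled by the supremum and the variation of its terms. -/
theorem abs_alternating_sum_le {u : ℕ → ℝ} {k : ℕ} {B V : ℝ} (hB : ∀ i < k, |u i| ≤ B)
    (hV : ∑ i ∈ Finset.range (k - 1), |u (i + 1) - u i| ≤ V) (hB0 : 0 ≤ B) (hV0 : 0 ≤ V) :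
    |∑ i ∈ Finset.range k, (-1) ^ i * u i| ≤ B + V := by
  rcases k with _ | k
  · simp; linarith
  have h := two_mul_alternating_sum u k
  have h0 := hB 0 (by omega)
  have h1 := hB k (by omega)
  have h2 : |∑ i ∈ Finset.range k, (-1) ^ i * (u (i + 1) - u i)| ≤ V := by
    refine (Finset.abs_sum_le_sum_abs _ _).trans (le_trans (le_of_eq ?_) hV)
    refine Finset.sum_congr rfl fun i _ => by simp [abs_mul]
  have h3 : |(-1) ^ k * u k| ≤ B := by simpa [abs_mul] using h1
  rw [abs_le] at *
  constructor <;> linarith [h0.1, h0.2, h2.1, h2.2, h3.1, h3.2]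

theorem sum_mul_eq_by_parts (c s : ℕ → ℝ) (m : ℕ) :
    ∑ i ∈ Finset.range m, c i * s i = c m * ∑ i ∈ Finset.range m, s i +
      ∑ i ∈ Finset.range m, (c i - c (i + 1)) * ∑ l ∈ Finset.range (i + 1), s l := by
  induction m with
  | zero => simp
  | succ m ih =>
    rw [Finset.sum_range_succ, ih, Finset.sum_range_succ _ m, Finset.sum_range_succ _ m]
    simp only [Finset.sum_range_succ]
    ring

/-- Abel's inequality with partial sums of at most linear growth. -/
theorem abs_sum_mul_le_of_antitone {c s : ℕ → ℝ} (hc : Antitone c) (hc0 : ∀ i, 0 ≤ c i) {m : ℕ}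
    {M w : ℝ} (hs : ∀ k ≤ m, |∑ i ∈ Finset.range k, s i| ≤ M + k * w) :
    |∑ i ∈ Finset.range m, c i * s i| ≤ c 0 * M + w * ∑ i ∈ Finset.range m, c i := by
  -- The claimed bound is what summation by parts gives when each partial sum is replaced by its
  -- bound `M + k w`; the comparison is then termwise.
  have key : c 0 * M + w * ∑ i ∈ Finset.range m, c i = c m * (M + m * w) +
      ∑ i ∈ Finset.range m, (c i - c (i + 1)) * (M + ((i + 1 : ℕ) : ℝ) * w) := by
    clear hs
    induction m with
    | zero => simp
    | succ m ih =>
      rw [Finset.sum_range_succ, mul_add, ← add_assoc, ih, Finset.sum_range_succ]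
      push_cast
      ring
  rw [sum_mul_eq_by_parts, key]
  refine (abs_add_le _ _).trans (add_le_add ?_ ?_)
  · rw [abs_mul, abs_of_nonneg (hc0 m)]
    exact mul_le_mul_of_nonneg_left (hs m le_rfl) (hc0 m)
  · refine (Finset.abs_sum_le_sum_abs _ _).trans (Finset.sum_le_sum fun i hi => ?_)
    have h : 0 ≤ c i - c (i + 1) := sub_nonneg.mpr (hc (Nat.le_succ i))
    rw [abs_mul, abs_of_nonneg h]
    exact mul_le_mul_of_nonneg_left (hs _ (Finset.mem_range.mp hi)) h

/-- An alternating sum with antitone weights of harmonic size: the first `J` terms are estimated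
by their size, the others by Abel's inequality. -/
theorem abs_weighted_alternating_sum_le {b e : ℕ → ℝ} (hb : Antitone b) (hb0 : ∀ i, 0 ≤ b i)
    (hb2 : ∀ i : ℕ, b i ≤ 2 / (i + 1)) {m J : ℕ} {M w η : ℝ} (hM : 0 ≤ M) (hw : 0 ≤ w) (hη : 0 ≤ η)
    (he : ∀ i < J, i < m → |e i| ≤ η)
    (hs : ∀ a k, a + k ≤ m → |∑ i ∈ Finset.range k, (-1) ^ i * e (a + i)| ≤ M + k * w) :
    |∑ i ∈ Finset.range m, (-1) ^ i * (b i * e i)| ≤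
      2 * J * η + 2 * M / (J + 1) + 2 * w * (1 + Real.log m) := by
  have hlog : ∑ i ∈ Finset.range m, b i ≤ 2 * (1 + Real.log m) := by
    have h1 : ∑ i ∈ Finset.range m, b i ≤ 2 * (harmonic m : ℝ) := by
      rw [harmonic]
      push_cast
      rw [Finset.mul_sum]
      exact Finset.sum_le_sum fun i _ => (hb2 i).trans_eq (div_eq_mul_inv _ _)
    linarith [harmonic_le_one_add_log m]
  have hlog0 : 0 ≤ 1 + Real.log m := by
    rcases Nat.eq_zero_or_pos m with rfl | h
    · simp
    · have := Real.log_nonneg (by exact_mod_cast h : (1 : ℝ) ≤ m)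
      linarith
  -- A general `p ≤ J` covers both the case `m ≤ J` and the initial block of length `J`.
  have near : ∀ p ≤ J, p ≤ m → |∑ i ∈ Finset.range p, (-1) ^ i * (b i * e i)| ≤ 2 * J * η := by
    intro p hp hpm
    have h1 : |∑ i ∈ Finset.range p, (-1) ^ i * (b i * e i)| ≤
        ∑ i ∈ Finset.range p, 2 * η := by
      refine (Finset.abs_sum_le_sum_abs _ _).trans (Finset.sum_le_sum fun i hi => ?_)
      rw [Finset.mem_range] at hi
      rw [abs_mul, abs_mul, abs_pow, abs_neg, abs_one, one_pow, one_mul, abs_of_nonneg (hb0 i)]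
      refine mul_le_mul ((hb2 i).trans ?_) (he i (by omega) (by omega)) (abs_nonneg _) zero_le_two
      rw [div_le_iff₀ (by positivity)]
      have : (0 : ℝ) ≤ i := i.cast_nonneg
      linarith
    rw [Finset.sum_const, Finset.card_range, nsmul_eq_mul] at h1
    have : (p : ℝ) ≤ J := by exact_mod_cast hp
    nlinarith
  have hfar : 0 ≤ 2 * M / (J + 1) + 2 * w * (1 + Real.log m) := by positivity
  rcases le_total m J with hmJ | hmJ
  · linarith [near m hmJ le_rfl]
  obtain ⟨r, rfl⟩ := Nat.exists_eq_add_of_le hmJ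
  rw [Finset.sum_range_add]
  -- Abel's inequality restarted at `J`: the constant `M` is now multiplied by `b J ≤ 2/(J+1)` only.
  have h2 : |∑ i ∈ Finset.range r, (-1) ^ (J + i) * (b (J + i) * e (J + i))| ≤
      b (J + 0) * M + w * ∑ i ∈ Finset.range r, b (J + i) := by
    have h3 : ∑ i ∈ Finset.range r, (-1) ^ (J + i) * (b (J + i) * e (J + i)) =
        (-1) ^ J * ∑ i ∈ Finset.range r, b (J + i) * ((-1) ^ i * e (J + i)) := by
      rw [Finset.mul_sum]
      refine Finset.sum_congr rfl fun i _ => by rw [pow_add]; ring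
    rw [h3, abs_mul, abs_pow, abs_neg, abs_one, one_pow, one_mul]
    exact abs_sum_mul_le_of_antitone (c := fun i => b (J + i))
      (fun i j hij => hb (by omega)) (fun i => hb0 _) fun k hk => hs J k (by omega)
  have h4 : ∑ i ∈ Finset.range r, b (J + i) ≤ 2 * (1 + Real.log (J + r : ℕ)) := by
    refine le_trans ?_ hlog
    rw [Finset.sum_range_add]
    exact le_add_of_nonneg_left (Finset.sum_nonneg fun i _ => hb0 i)
  have h5 : b (J + 0) * M ≤ 2 * M / (J + 1) := by
    rw [add_zero, mul_comm 2 M, mul_div_assoc, mul_comm]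
    exact mul_le_mul_of_nonneg_left (hb2 J) hM
  have h6 := mul_le_mul_of_nonneg_left h4 hw
  refine (abs_add_le _ _).trans ?_
  linarith [near J le_rfl (by omega)]

/-! ### Estimates of the kernel -/

theorem cos_sub_cos_pos {a b : ℝ} (ha : 0 < a) (hb : b < Real.pi) (hab : a < b) :
    0 < Real.cos a - Real.cos b :=
  sub_pos.mpr (Real.cos_lt_cos_of_nonneg_of_le_pi ha.le hb.le hab)

/-- Both sides contain the factor `2 sin((b'-b)/2)`. The remaining cosines compare because
`(b'+b)/2` lies between `(b'-b)/2` and `π - (b'-b)/2`. -/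
theorem abs_sin_sub_sin_le_sin_sub {b b' : ℝ} (hb : 0 < b) (hb' : b' < Real.pi) (h : b ≤ b') :
    |Real.sin b' - Real.sin b| ≤ Real.sin (b' - b) := by
  have h1 : Real.sin (b' - b) = 2 * Real.sin ((b' - b) / 2) * Real.cos ((b' - b) / 2) := by
    rw [← Real.sin_two_mul]; congr 1; ring
  have h0 : 0 ≤ Real.sin ((b' - b) / 2) :=
    Real.sin_nonneg_of_nonneg_of_le_pi (by linarith) (by linarith)
  have h2 : |Real.cos ((b' + b) / 2)| ≤ Real.cos ((b' - b) / 2) := by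
    rw [abs_le]
    constructor
    · rw [neg_le, ← Real.cos_pi_sub]
      exact Real.cos_le_cos_of_nonneg_of_le_pi (by linarith) (by linarith) (by linarith)
    · exact Real.cos_le_cos_of_nonneg_of_le_pi (by linarith) (by linarith) (by linarith)
  rw [Real.sin_sub_sin, h1, abs_mul, abs_of_nonneg (by linarith)]
  exact mul_le_mul_of_nonneg_left h2 (by linarith)

/-- Over the common denominator, the difference has numerator `sin(b'-b) - cos a (sin b' - sin b)`,
nonnegative by the previous inequality on sines. Hypothesis `hD` expresses that `b` and `b'` lie on
the same side of `a`. -/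
theorem kernel_antitone {a b b' : ℝ} (hb : 0 < b) (hb' : b' < Real.pi) (h : b ≤ b')
    (hD : 0 < (Real.cos a - Real.cos b) * (Real.cos a - Real.cos b')) :
    kernel a b' ≤ kernel a b := by
  have h1 := abs_sin_sub_sin_le_sin_sub hb hb' h
  have h2 : |Real.cos a * (Real.sin b' - Real.sin b)| ≤ Real.sin (b' - b) := by
    rw [abs_mul]
    exact (mul_le_of_le_one_left (abs_nonneg _) (Real.abs_cos_le_one a)).trans h1
  have h3 := (abs_le.mp h2).2
  rw [Real.sin_sub] at h3
  have hD1 : Real.cos a - Real.cos b ≠ 0 := left_ne_zero_of_mul hD.ne'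
  have hD2 : Real.cos a - Real.cos b' ≠ 0 := right_ne_zero_of_mul hD.ne'
  rw [← sub_nonneg, kernel, kernel, div_sub_div _ _ hD1 hD2]
  refine div_nonneg ?_ hD.le
  linarith

theorem mul_cos_le_sin {h : ℝ} (h0 : 0 ≤ h) (h1 : h < Real.pi / 2) : h * Real.cos h ≤ Real.sin h := by
  have hc : 0 < Real.cos h := Real.cos_pos_of_mem_Ioo ⟨by linarith, h1⟩
  have := Real.le_tan h0 h1
  rwa [Real.tan_eq_sin_div_cos, le_div_iff₀ hc] at this

/-- In terms of the half-sum and the half-difference `h`, this is `h cos h ≤ sin h`, that is `h ≤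
tan h`, multiplied by the sine of the half-sum. -/
theorem sin_mul_sub_le {a b : ℝ} (ha : 0 ≤ a) (hb : b ≤ Real.pi) (hab : a < b)
    (hne : b - a < Real.pi) :
    (Real.sin a + Real.sin b) * (b - a) ≤ 2 * (Real.cos a - Real.cos b) := by
  have hs : 0 ≤ Real.sin ((b + a) / 2) :=
    Real.sin_nonneg_of_nonneg_of_le_pi (by linarith) (by linarith)
  have h1 := mul_cos_le_sin (h := (b - a) / 2) (by linarith) (by linarith)
  have h2 : Real.cos a - Real.cos b = 2 * Real.sin ((b + a) / 2) * Real.sin ((b - a) / 2) := by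
    rw [Real.cos_sub_cos, show (a - b) / 2 = -((b - a) / 2) by ring, Real.sin_neg, add_comm a b]
    ring
  have h3 : Real.sin a + Real.sin b = 2 * Real.sin ((b + a) / 2) * Real.cos ((b - a) / 2) := by
    have e1 : a = (b + a) / 2 - (b - a) / 2 := by ring
    have e2 : b = (b + a) / 2 + (b - a) / 2 := by ring
    have e3 := Real.sin_sub ((b + a) / 2) ((b - a) / 2)
    have e4 := Real.sin_add ((b + a) / 2) ((b - a) / 2)
    rw [← e1] at e3
    rw [← e2] at e4
    rw [e3, e4]; ring
  rw [h2, h3]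
  nlinarith [mul_le_mul_of_nonneg_left h1 hs]

theorem kernel_right_le {a b : ℝ} (ha : 0 < a) (hb : b < Real.pi) (hab : a < b) :
    kernel a b ≤ 2 / (b - a) := by
  have h := sin_mul_sub_le ha.le hb.le hab (by linarith)
  have hs := Real.sin_pos_of_pos_of_lt_pi ha (by linarith)
  rw [kernel, div_le_div_iff₀ (cos_sub_cos_pos ha hb hab) (by linarith)]
  nlinarith

theorem kernel_left_le {a b : ℝ} (hb : 0 < b) (ha : a < Real.pi) (hab : b < a) :
    -kernel a b ≤ 2 / (a - b) := by
  have h := sin_mul_sub_le hb.le ha.le hab (by linarith)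
  have hs := Real.sin_pos_of_pos_of_lt_pi (hb.trans hab) ha
  rw [kernel, ← div_neg, neg_sub, div_le_div_iff₀ (cos_sub_cos_pos hb ha hab) (by linarith)]
  nlinarith

theorem kernel_right_nonneg {a b : ℝ} (ha : 0 < a) (hb : b < Real.pi) (hab : a < b) :
    0 ≤ kernel a b :=
  div_nonneg (Real.sin_nonneg_of_nonneg_of_le_pi (by linarith) hb.le) (cos_sub_cos_pos ha hb hab).le

theorem kernel_left_nonneg {a b : ℝ} (hb : 0 < b) (ha : a < Real.pi) (hab : b < a) :
    0 ≤ -kernel a b := by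
  rw [kernel, ← div_neg, neg_sub]
  exact div_nonneg (Real.sin_nonneg_of_nonneg_of_le_pi hb.le (by linarith))
    (cos_sub_cos_pos hb ha hab).le

/-! ### The weights on both sides of a point -/

/-- The absolute values of the fundamental polynomials at `cos θ`, for the nodes to the left. -/
def weightLeft (n : ℕ) (θ : ℝ) (j : ℕ) : ℝ :=
  if j < posFloor n θ then
    Real.sin (Real.pi * posFract n θ) * (-kernel θ (angle n (posFloor n θ - j)) / n) else 0

/-- The absolute values of the fundamental polynomials at `cos θ`, for the nodes to the right. -/
def weightRight (n : ℕ) (θ : ℝ) (j : ℕ) : ℝ :=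
  if j < n - posFloor n θ then
    Real.sin (Real.pi * posFract n θ) * (kernel θ (angle n (posFloor n θ + 1 + j)) / n) else 0

theorem sin_pi_mul_posFract_nonneg (n : ℕ) (θ : ℝ) :
    0 ≤ Real.sin (Real.pi * posFract n θ) := by
  have h0 := posFract_nonneg n θ
  have h1 := posFract_lt_one n θ
  have := Real.pi_pos
  exact Real.sin_nonneg_of_nonneg_of_le_pi (by positivity) (by nlinarith)

/-- Makes the weight bound uniform in `t`: the kernel at the nearest node is of order `1/t`, but `s
= sin(πt)` compensates. Indeed `s ≤ πt` and `s j ≤ π j` add up to `s (j+1) ≤ π (j+t)`. On the right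
side it is applied with `1 - t`. -/
theorem harmonic_bound {s t j n κ δ : ℝ} (hs1 : s ≤ 1) (hst : s ≤ Real.pi * t) (hs0 : 0 ≤ s)
    (ht : 0 < t) (hj : 0 ≤ j) (hn : 0 < n) (hδ : δ = Real.pi / n * (j + t)) (hκ : κ ≤ 2 / δ) :
    s * (κ / n) ≤ 2 / (j + 1) := by
  have hpi := Real.pi_pos
  have h1 : s * (κ / n) ≤ s * (2 / δ / n) := by gcongr
  refine h1.trans ?_
  have h2 : s * (2 / δ / n) = 2 * s / (Real.pi * (j + t)) := by
    rw [hδ]; field_simp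
  rw [h2, div_le_div_iff₀ (by positivity) (by positivity)]
  have h3 : s * j ≤ Real.pi * j := by
    have := Real.pi_gt_three
    gcongr
    linarith
  nlinarith

section
variable {n : ℕ} {θ : ℝ}

theorem angle_left_lt (hn : 0 < n) (hθ : 0 < θ) (ht : 0 < posFract n θ) {j : ℕ}
    (hj : j < posFloor n θ) : angle n (posFloor n θ - j) < θ := by
  have h := sub_angle_left hn hθ.le hj
  have : 0 < Real.pi / n * (posFract n θ + j) := by
    have := Real.pi_pos
    positivity
  linarith

theorem left_mem_Icc (hθ : 0 < θ) (hθ' : θ < Real.pi) {j : ℕ} (hj : j < posFloor n θ) :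
    posFloor n θ - j ∈ Finset.Icc 1 n := by
  have := posFloor_le (n := n) hθ.le hθ'.le
  rw [Finset.mem_Icc]; omega

theorem right_mem_Icc {j : ℕ} (hj : j < n - posFloor n θ) :
    posFloor n θ + 1 + j ∈ Finset.Icc 1 n := by
  rw [Finset.mem_Icc]; omega

theorem weightLeft_nonneg (hn : 0 < n) (hθ : 0 < θ) (hθ' : θ < Real.pi) (ht : 0 < posFract n θ)
    (j : ℕ) : 0 ≤ weightLeft n θ j := by
  unfold weightLeft
  split_ifs with hj
  · exact mul_nonneg (sin_pi_mul_posFract_nonneg n θ) (div_nonneg (kernel_left_nonneg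
      (angle_pos (left_mem_Icc hθ hθ' hj)) hθ' (angle_left_lt hn hθ ht hj)) n.cast_nonneg)
  · exact le_rfl

theorem weightRight_nonneg (hn : 0 < n) (hθ : 0 < θ) (j : ℕ) : 0 ≤ weightRight n θ j := by
  unfold weightRight
  split_ifs with hj
  · exact mul_nonneg (sin_pi_mul_posFract_nonneg n θ) (div_nonneg (kernel_right_nonneg
      hθ (angle_lt_pi (right_mem_Icc hj)) (lt_angle_right hn hθ.le j)) n.cast_nonneg)
  · exact le_rfl

theorem weightLeft_antitone (hn : 0 < n) (hθ : 0 < θ) (hθ' : θ < Real.pi)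
    (ht : 0 < posFract n θ) : Antitone (weightLeft n θ) := by
  refine antitone_nat_of_succ_le fun j => ?_
  by_cases hj : j + 1 < posFloor n θ
  · have hj' : j < posFloor n θ := by omega
    unfold weightLeft
    rw [if_pos hj, if_pos hj']
    refine mul_le_mul_of_nonneg_left ?_ (sin_pi_mul_posFract_nonneg n θ)
    gcongr
    have hm := left_mem_Icc hθ hθ' hj
    have hm' := left_mem_Icc hθ hθ' hj'
    have hl := angle_left_lt hn hθ ht hj
    have hl' := angle_left_lt hn hθ ht hj'
    refine kernel_antitone (angle_pos hm) (angle_lt_pi hm')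
      ((angle_strictMono hn).monotone (by omega)) (mul_pos_of_neg_of_neg ?_ ?_)
    · linarith [cos_sub_cos_pos (angle_pos hm) hθ' hl]
    · linarith [cos_sub_cos_pos (angle_pos hm') hθ' hl']
  -- Past the last node the weights are `0` by convention, so nonnegativity suffices there.
  · have h : weightLeft n θ (j + 1) = 0 := by rw [weightLeft, if_neg hj]
    rw [h]
    exact weightLeft_nonneg hn hθ hθ' ht j

theorem weightRight_antitone (hn : 0 < n) (hθ : 0 < θ) : Antitone (weightRight n θ) := by
  refine antitone_nat_of_succ_le fun j => ?_
  by_cases hj : j + 1 < n - posFloor n θ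
  · have hj' : j < n - posFloor n θ := by omega
    unfold weightRight
    rw [if_pos hj, if_pos hj']
    refine mul_le_mul_of_nonneg_left ?_ (sin_pi_mul_posFract_nonneg n θ)
    gcongr
    have hm := right_mem_Icc hj
    have hm' := right_mem_Icc hj'
    exact kernel_antitone (angle_pos hm') (angle_lt_pi hm)
      ((angle_strictMono hn).monotone (by omega)) (mul_pos
        (cos_sub_cos_pos hθ (angle_lt_pi hm') (lt_angle_right hn hθ.le j))
        (cos_sub_cos_pos hθ (angle_lt_pi hm) (lt_angle_right hn hθ.le (j + 1))))
  · have h : weightRight n θ (j + 1) = 0 := by rw [weightRight, if_neg hj]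
    rw [h]
    exact weightRight_nonneg hn hθ j

theorem weightLeft_le (hn : 0 < n) (hθ : 0 < θ) (hθ' : θ < Real.pi) (ht : 0 < posFract n θ)
    (j : ℕ) : weightLeft n θ j ≤ 2 / (j + 1) := by
  unfold weightLeft
  split_ifs with hj
  · refine harmonic_bound (Real.sin_le_one _) (Real.sin_le (by have := Real.pi_pos; positivity))
      (sin_pi_mul_posFract_nonneg n θ) ht j.cast_nonneg (by exact_mod_cast hn) ?_
      (kernel_left_le (angle_pos (left_mem_Icc hθ hθ' hj)) hθ' (angle_left_lt hn hθ ht hj))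
    rw [sub_angle_left hn hθ.le hj, add_comm]
  · positivity

theorem weightRight_le (hn : 0 < n) (hθ : 0 < θ) (j : ℕ) : weightRight n θ j ≤ 2 / (j + 1) := by
  unfold weightRight
  split_ifs with hj
  · have h1 : 0 < 1 - posFract n θ := by linarith [posFract_lt_one n θ]
    refine harmonic_bound (Real.sin_le_one _) ?_
      (sin_pi_mul_posFract_nonneg n θ) h1 j.cast_nonneg (by exact_mod_cast hn) ?_
      (kernel_right_le hθ (angle_lt_pi (right_mem_Icc hj)) (lt_angle_right hn hθ.le j))
    · rw [← Real.sin_pi_sub, show Real.pi - Real.pi * posFract n θ =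
        Real.pi * (1 - posFract n θ) by ring]
      exact Real.sin_le (by have := Real.pi_pos; positivity)
    · rw [angle_right_sub hn hθ.le]
  · positivity

/-- The value of the Lagrange operator, up to a constant, as two alternating sums. -/
theorem lagrangeOp_sub_eq (hn : 0 < n) (hθ : 0 < θ) (hθ' : θ < Real.pi) (ht : 0 < posFract n θ)
    (f : ℝ → ℝ) (c : ℝ) :
    lagrangeOp n f (Real.cos θ) - c =
      ∑ j ∈ Finset.range (posFloor n θ),
        (-1) ^ j * (weightLeft n θ j * (f (node n (posFloor n θ - j)) - c)) +
      ∑ j ∈ Finset.range (n - posFloor n θ),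
        (-1) ^ j * (weightRight n θ j * (f (node n (posFloor n θ + 1 + j)) - c)) := by
  rw [lagrangeOp_sub_eq_sum hn, sum_nodes_split (posFloor_le (n := n) hθ.le hθ'.le)]
  congr 1
  · refine Finset.sum_congr rfl fun j hj => ?_
    rw [Finset.mem_range] at hj
    rw [fundamental_left hn hθ hθ' ht.ne' hj, weightLeft, if_pos hj]
    ring
  · refine Finset.sum_congr rfl fun j hj => ?_
    rw [Finset.mem_range] at hj
    rw [fundamental_right hn hθ hj, weightRight, if_pos hj]
    ring

end

/-! ### Functions of controlled variation along the nodes -/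

/-- Bounded functions whose variation along `j` consecutive nodes of the `n`-th row is at most
`M + j * w n`. -/
structure NodeVariationBound (f : ℝ → ℝ) (M : ℝ) (w : ℕ → ℝ) : Prop where
  abs_le : ∀ x ∈ Set.Icc (-1 : ℝ) 1, |f x| ≤ M
  nonneg : ∀ n, 0 ≤ w n
  tendsto : Tendsto (fun n => w n * (1 + Real.log n)) atTop (𝓝 0)
  sum_le : ∀ n a j, 1 ≤ a → a + j ≤ n →
    ∑ i ∈ Finset.range j, |f (node n (a + i + 1)) - f (node n (a + i))| ≤ M + j * w n

/-- Functions of controlled variation along the Chebyshev nodes. -/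
def Admissible (f : ℝ → ℝ) : Prop :=
  ∃ M w, NodeVariationBound f M w

theorem NodeVariationBound.bound_nonneg {f : ℝ → ℝ} {M : ℝ} {w : ℕ → ℝ}
    (h : NodeVariationBound f M w) : 0 ≤ M :=
  (abs_nonneg _).trans (h.abs_le 0 (by norm_num))

theorem Admissible.add {f g : ℝ → ℝ} (hf : Admissible f) (hg : Admissible g) :
    Admissible (f + g) := by
  obtain ⟨M, w, h⟩ := hf
  obtain ⟨M', w', h'⟩ := hg
  refine ⟨M + M', w + w', ⟨fun x hx => ?_, fun n => ?_, ?_, fun n a j ha hj => ?_⟩⟩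
  · exact (abs_add_le _ _).trans (add_le_add (h.abs_le x hx) (h'.abs_le x hx))
  · exact add_nonneg (h.nonneg n) (h'.nonneg n)
  · simpa [add_mul] using h.tendsto.add h'.tendsto
  · calc _ ≤ ∑ i ∈ Finset.range j, (|f (node n (a + i + 1)) - f (node n (a + i))| +
          |g (node n (a + i + 1)) - g (node n (a + i))|) := by
          refine Finset.sum_le_sum fun i _ => ?_
          rw [Pi.add_apply, Pi.add_apply, add_sub_add_comm]
          exact abs_add_le _ _
      _ ≤ _ := by
          rw [Finset.sum_add_distrib]
          refine (add_le_add (h.sum_le n a j ha hj) (h'.sum_le n a j ha hj)).trans_eq ?_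
          simp; ring

theorem Admissible.smul {f : ℝ → ℝ} (hf : Admissible f) (c : ℝ) : Admissible (c • f) := by
  obtain ⟨M, w, h⟩ := hf
  refine ⟨|c| * M, fun n => |c| * w n, ⟨fun x hx => ?_, fun n => ?_, ?_, fun n a j ha hj => ?_⟩⟩
  · rw [Pi.smul_apply, smul_eq_mul, abs_mul]
    exact mul_le_mul_of_nonneg_left (h.abs_le x hx) (abs_nonneg c)
  · exact mul_nonneg (abs_nonneg c) (h.nonneg n)
  · simpa [mul_assoc] using h.tendsto.const_mul |c|
  · simp only [Pi.smul_apply, smul_eq_mul, ← mul_sub, abs_mul]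
    rw [← Finset.mul_sum]
    refine (mul_le_mul_of_nonneg_left (h.sum_le n a j ha hj) (abs_nonneg c)).trans_eq ?_
    ring

theorem Admissible.congr {f g : ℝ → ℝ} (hf : Admissible f)
    (h : ∀ x ∈ Set.Icc (-1 : ℝ) 1, g x = f x) : Admissible g := by
  obtain ⟨M, w, hM⟩ := hf
  refine ⟨M, w, ⟨fun x hx => by rw [h x hx]; exact hM.abs_le x hx, hM.nonneg, hM.tendsto,
    fun n a j ha hj => ?_⟩⟩
  simp_rw [fun k => h _ (node_mem_Icc n k)]
  exact hM.sum_le n a j ha hj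

/-- Here `w = 0`. The constant `|f 0| + V` bounds `f` as well as its variation along any row. -/
theorem admissible_of_boundedVariationOn {f : ℝ → ℝ}
    (hf : BoundedVariationOn f (Set.Icc (-1) 1)) : Admissible f := by
  set V := (eVariationOn f (Set.Icc (-1) 1)).toReal with hV
  have hV0 : 0 ≤ V := ENNReal.toReal_nonneg
  have hle : V ≤ |f 0| + V := le_add_of_nonneg_left (abs_nonneg _)
  refine ⟨|f 0| + V, 0, ⟨fun x hx => ?_, fun n => le_rfl, by simp, fun n a j ha hj => ?_⟩⟩
  · have h1 := hf.dist_le hx (by norm_num : (0 : ℝ) ∈ Set.Icc (-1 : ℝ) 1)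
    rw [Real.dist_eq] at h1
    have := abs_sub_abs_le_abs_sub (f x) (f 0)
    linarith
  · rw [Pi.zero_apply, mul_zero, add_zero]
    refine le_trans ?_ hle
    have hanti : AntitoneOn (fun i => node n (a + i)) (Set.Icc 0 j) := by
      intro i hi i' hi' hii
      rcases hii.eq_or_lt with rfl | hlt
      · exact le_rfl
      · refine (node_lt_node ?_ ?_ (by omega)).le <;>
        · rw [Set.mem_Icc] at hi hi'
          rw [Finset.mem_Icc]
          omega
    -- The nodes decrease with their index, so they are enumerated backwards.
    have h2 := eVariationOn.sum_le_of_monotoneOn_Icc (f := f) (s := Set.Icc (-1) 1)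
      (m := 0) (n := j) (u := fun i => node n (a + (j - i)))
      (fun i hi i' hi' hii => hanti (by simp) (by simp) (by omega))
      (fun i _ => node_mem_Icc n _)
    rw [hV, ← ENNReal.ofReal_le_iff_le_toReal hf]
    refine le_trans (le_of_eq ?_) h2
    rw [ENNReal.ofReal_sum_of_nonneg fun _ _ => abs_nonneg _, ← Finset.sum_range_reflect,
      Finset.range_eq_Ico]
    refine Finset.sum_congr rfl fun i hi => ?_
    rw [Finset.mem_Ico] at hi
    rw [edist_dist, Real.dist_eq, abs_sub_comm]
    rw [show a + (j - 1 - i) + 1 = a + (j - i) by omega,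
      show a + (j - 1 - i) = a + (j - (i + 1)) by omega, abs_sub_comm]

theorem abs_cos_sub_cos_le (a b : ℝ) : |Real.cos a - Real.cos b| ≤ |a - b| := by
  have := Real.lipschitzWith_cos.dist_le_mul a b
  simpa [Real.dist_eq] using this

theorem abs_sub_le_modulus {F : ℝ → ℝ} (hF : ContinuousOn F (Set.Icc (-1) 1)) {x y δ : ℝ}
    (hx : x ∈ Set.Icc (-1 : ℝ) 1) (hy : y ∈ Set.Icc (-1 : ℝ) 1) (h : |x - y| ≤ δ) :
    |F x - F y| ≤ modulus F δ := by
  obtain ⟨C, hC⟩ := isCompact_Icc.exists_bound_of_continuousOn hF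
  refine le_csSup ⟨C + C, ?_⟩ ⟨x, hx, y, hy, h, rfl⟩
  rintro r ⟨a, ha, b, hb, -, rfl⟩
  exact (abs_sub _ _).trans (add_le_add (hC a ha) (hC b hb))

theorem angle_succ_sub (n k : ℕ) : angle n (k + 1) - angle n k = Real.pi / n := by
  unfold angle
  rcases eq_or_ne (n : ℝ) 0 with h | h
  · simp [h]
  · push_cast
    field_simp
    ring

theorem tendsto_log_nat : Tendsto (fun n : ℕ => Real.log n) atTop atTop :=
  Real.tendsto_log_atTop.comp tendsto_natCast_atTop_atTop

/-- Consecutive angles differ by `π/n` and the cosine is 1-Lipschitz, so each increment is at most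
`ω(F, π/n)`, which is the choice of `w n`. The Dini–Lipschitz condition is exactly `w n log n → 0`.
-/
theorem admissible_of_diniLipschitz {F : ℝ → ℝ} (hF : DiniLipschitz F) : Admissible F := by
  obtain ⟨hc, hω⟩ := hF
  obtain ⟨C, hC⟩ := isCompact_Icc.exists_bound_of_continuousOn hc
  have hC0 : 0 ≤ C := (norm_nonneg _).trans (hC 0 (by norm_num))
  have hpi := Real.pi_pos
  have h0 : (0 : ℝ) ∈ Set.Icc (-1 : ℝ) 1 := by norm_num
  have hnn : ∀ n : ℕ, 0 ≤ modulus F (Real.pi / n) := fun n =>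
    (abs_nonneg _).trans (abs_sub_le_modulus hc h0 h0 (by simp; positivity))
  refine ⟨C, fun n => modulus F (Real.pi / n), ⟨hC, hnn, ?_, fun n a j ha hj => ?_⟩⟩
  · have hlim : Tendsto (fun n : ℕ => Real.pi / (n : ℝ)) atTop (𝓝[>] 0) := by
      refine tendsto_nhdsWithin_iff.mpr ⟨tendsto_const_div_atTop_nhds_zero_nat _, ?_⟩
      filter_upwards [eventually_gt_atTop 0] with n hn
      have : (0 : ℝ) < n := by exact_mod_cast hn
      exact div_pos hpi this
    have h1 := hω.comp_tendsto hlim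
    refine (Asymptotics.isLittleO_one_iff ℝ).mp ?_
    -- The condition at `δ = π/n` involves `|log(π/n)| = |log n - log π|`, of the same order as `1 +
    -- log n`.
    have h2 : (fun n : ℕ => 1 + Real.log n) =O[atTop] fun n : ℕ => Real.log n - Real.log Real.pi := by
      have hc1 : ∀ c : ℝ, (fun _ : ℕ => c) =o[atTop] fun n : ℕ => Real.log n := fun c =>
        Asymptotics.isLittleO_const_left.mpr (Or.inr (tendsto_norm_atTop_atTop.comp tendsto_log_nat))
      have e1 : (fun n : ℕ => 1 + Real.log n) =O[atTop] fun n : ℕ => Real.log n :=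
        (hc1 1).isBigO.add (Asymptotics.isBigO_refl _ _)
      exact e1.trans ((hc1 (Real.log Real.pi)).right_isBigO_sub)
    have h3 := h1.mul_isBigO h2
    refine h3.trans_isBigO (Asymptotics.IsBigO.of_bound 1 ?_)
    filter_upwards [eventually_gt_atTop 0] with n hn
    have hn' : (n : ℝ) ≠ 0 := by exact_mod_cast hn.ne'
    simp only [Function.comp_apply]
    rw [Real.log_div hpi.ne' hn', abs_sub_comm, norm_mul, norm_inv, Real.norm_eq_abs, abs_abs,
      Real.norm_eq_abs]
    simpa using inv_mul_le_one
  · calc _ ≤ ∑ i ∈ Finset.range j, modulus F (Real.pi / n) := by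
          refine Finset.sum_le_sum fun i _ => ?_
          refine abs_sub_le_modulus hc (node_mem_Icc _ _) (node_mem_Icc _ _) ?_
          rw [node_eq_cos_angle, node_eq_cos_angle]
          refine (abs_cos_sub_cos_le _ _).trans_eq ?_
          rw [angle_succ_sub, abs_of_nonneg (by positivity)]
      _ ≤ _ := by
          rw [Finset.sum_const, Finset.card_range, nsmul_eq_mul]
          exact le_add_of_nonneg_left hC0

theorem admissible_stepFun (x₀ d : ℝ) : Admissible (stepFun x₀ d) := by
  have mono : ∀ p : ℝ → Prop, (∀ x y, x ≤ y → p x → p y) → ∀ _ : DecidablePred p,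
      Admissible fun x => if p x then 1 else 0 := by
    intro p hp _
    refine admissible_of_boundedVariationOn
      (MonotoneOn.boundedVariationOn (C := 1) (fun x _ y _ hxy => ?_) (fun x _ => ?_))
    · by_cases hx : p x
      · simp [hx, hp x y hxy hx]
      · simp only [hx, if_false]
        split_ifs <;> norm_num
    · split_ifs <;> norm_num
  -- The step is `(1-d)` times the indicator of `x > x₀` plus `d` times that of `x ≥ x₀`, both
  -- monotone.
  refine (((mono (fun x => x₀ < x) (fun x y hxy hx => hx.trans_le hxy) inferInstance).smul
    (1 - d)).add ((mono (fun x => x₀ ≤ x) (fun x y hxy hx => hx.trans hxy) inferInstance).smul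
    d)).congr fun x _ => ?_
  rcases lt_trichotomy x x₀ with h | h | h
  · simp [stepFun, h, h.not_gt, h.not_ge]
  · simp [stepFun, h]
  · simp [stepFun, h, h.not_gt, h.le, h.ne']

theorem admissible_of_mem_stepSpace {h : ℝ → ℝ} (hh : h ∈ stepSpace) : Admissible h := by
  induction hh using Submodule.span_induction with
  | mem x hx =>
    obtain ⟨x₀, -, d, rfl⟩ := hx
    exact admissible_stepFun x₀ d
  | zero => exact ⟨0, 0, ⟨by simp, by simp, by simp, by simp⟩⟩
  | add x y _ _ hx hy => exact hx.add hy
  | smul c x _ hx => exact hx.smul c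

theorem admissible_of_diniLipschitzPlusSteps {f : ℝ → ℝ} (hf : DiniLipschitzPlusSteps f) :
    Admissible f := by
  obtain ⟨F, hF, h, hh, hfe⟩ := hf
  exact ((admissible_of_diniLipschitz hF).add (admissible_of_mem_stepSpace hh)).congr hfe

/-! ### Uniform convergence -/

/-- The constant is `2M` for the size of `f - f x` plus `M` from the variation. The variation enters
as a hypothesis because the nodes are traversed in either direction. -/
theorem NodeVariationBound.abs_alternating_sum_le {f : ℝ → ℝ} {M : ℝ} {w : ℕ → ℝ}
    (h : NodeVariationBound f M w) {n : ℕ} {x : ℝ} (hx : x ∈ Set.Icc (-1 : ℝ) 1) {u : ℕ → ℝ}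
    {k : ℕ} (hu : ∀ i < k, ∃ l, u i = f (node n l) - f x)
    (hV : ∑ i ∈ Finset.range (k - 1), |u (i + 1) - u i| ≤ M + (k - 1 : ℕ) * w n) :
    |∑ i ∈ Finset.range k, (-1) ^ i * u i| ≤ 3 * M + k * w n := by
  have hM := h.bound_nonneg
  have hw := h.nonneg n
  have h1 := LagrangeIndex.abs_alternating_sum_le (B := 2 * M) (fun i hi => ?_) hV (by positivity)
    (by positivity)
  · refine h1.trans ?_
    have : ((k - 1 : ℕ) : ℝ) ≤ k := by exact_mod_cast Nat.sub_le k 1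
    nlinarith
  · obtain ⟨l, hl⟩ := hu i hi
    rw [hl]
    refine (abs_sub _ _).trans ?_
    linarith [h.abs_le _ (node_mem_Icc n l), h.abs_le x hx]

/-- The main estimate, with one copy of the weighted alternating bound for each side of `θ`. The
radius `π/n (J+1)` covers the `J` nearest nodes on each side. -/
theorem NodeVariationBound.abs_lagrangeOp_sub_le {f : ℝ → ℝ} {M : ℝ} {w : ℕ → ℝ}
    (h : NodeVariationBound f M w) {n : ℕ} (hn : 0 < n) {θ : ℝ} (hθ : 0 < θ) (hθ' : θ < Real.pi)
    {J : ℕ} {η : ℝ} (hη : 0 ≤ η)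
    (hf : ∀ y, |y - Real.cos θ| ≤ Real.pi / n * (J + 1) → |f y - f (Real.cos θ)| ≤ η) :
    |lagrangeOp n f (Real.cos θ) - f (Real.cos θ)| ≤
      2 * (2 * J * η + 2 * (3 * M) / (J + 1) + 2 * w n * (1 + Real.log n)) := by
  have hM := h.bound_nonneg
  have hw := h.nonneg n
  have hn1 : (1 : ℝ) ≤ n := by exact_mod_cast hn
  have hx : Real.cos θ ∈ Set.Icc (-1 : ℝ) 1 := ⟨Real.neg_one_le_cos _, Real.cos_le_one _⟩
  rcases (posFract_nonneg n θ).eq_or_lt with ht | ht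
  · obtain ⟨hk, he⟩ := eq_node_of_posFract_eq_zero hn hθ hθ' ht.symm
    rw [he, lagrangeOp_node hk, sub_self, abs_zero]
    have := Real.log_nonneg hn1
    positivity
  have hlog : ∀ m : ℕ, m ≤ n → 2 * J * η + 2 * (3 * M) / (J + 1) + 2 * w n * (1 + Real.log m) ≤
      2 * J * η + 2 * (3 * M) / (J + 1) + 2 * w n * (1 + Real.log n) := by
    intro m hm
    have : Real.log m ≤ Real.log n := by
      rcases Nat.eq_zero_or_pos m with rfl | hm0
      · simpa using Real.log_nonneg hn1
      · exact Real.log_le_log (by exact_mod_cast hm0) (by exact_mod_cast hm)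
    gcongr
  have hk := posFloor_le (n := n) hθ.le hθ'.le
  have hpi := Real.pi_pos
  rw [lagrangeOp_sub_eq hn hθ hθ' ht]
  refine (abs_add_le _ _).trans ?_
  rw [two_mul]
  refine add_le_add ((abs_weighted_alternating_sum_le (weightLeft_antitone hn hθ hθ' ht)
    (weightLeft_nonneg hn hθ hθ' ht) (weightLeft_le hn hθ hθ' ht) (M := 3 * M) (by positivity)
    hw hη (J := J) ?_ ?_).trans (hlog _ hk)) ((abs_weighted_alternating_sum_le
      (weightRight_antitone hn hθ) (weightRight_nonneg hn hθ) (weightRight_le hn hθ) (M := 3 * M)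
      (by positivity) hw hη (J := J) ?_ ?_).trans (hlog _ (Nat.sub_le _ _)))
  · intro i hi him
    refine hf _ ?_
    rw [node_eq_cos_angle]
    refine (abs_cos_sub_cos_le _ _).trans ?_
    rw [abs_sub_comm, sub_angle_left hn hθ.le him, abs_of_nonneg (by positivity)]
    have : (i : ℝ) ≤ J := by exact_mod_cast hi.le
    have := posFract_lt_one n θ
    exact mul_le_mul_of_nonneg_left (by linarith) (by positivity)
  · intro a k hak
    refine h.abs_alternating_sum_le hx (u := fun i => f (node n (posFloor n θ - (a + i))) -
      f (Real.cos θ)) (fun i _ => ⟨_, rfl⟩) ?_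
    rcases Nat.eq_zero_or_pos k with rfl | hk0
    · simpa using hM
    refine le_trans (le_of_eq ?_) (h.sum_le n (posFloor n θ - (a + k) + 1) (k - 1) (by omega)
      (by omega))
    -- On the left the index falls as `i` grows; the block of `k` nodes, of indices `posFloor -
    -- (a+k) + 1` to `posFloor - a`, is read upwards.
    rw [← Finset.sum_range_reflect]
    refine Finset.sum_congr rfl fun i hi => ?_
    rw [Finset.mem_range] at hi
    rw [sub_sub_sub_cancel_right, abs_sub_comm]
    rw [show posFloor n θ - (a + (k - 1 - 1 - i)) = posFloor n θ - (a + k) + 1 + i + 1 by omega,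
      show posFloor n θ - (a + (k - 1 - 1 - i + 1)) = posFloor n θ - (a + k) + 1 + i by omega]
  · intro i hi him
    refine hf _ ?_
    rw [node_eq_cos_angle]
    refine (abs_cos_sub_cos_le _ _).trans ?_
    have h1 : 0 < 1 - posFract n θ := by linarith [posFract_lt_one n θ]
    rw [angle_right_sub hn hθ.le, abs_of_nonneg (by positivity)]
    have : (i : ℝ) ≤ J := by exact_mod_cast hi.le
    gcongr
    linarith
  · intro a k hak
    refine h.abs_alternating_sum_le hx (u := fun i => f (node n (posFloor n θ + 1 + (a + i))) -
      f (Real.cos θ)) (fun i _ => ⟨_, rfl⟩) ?_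
    rcases Nat.eq_zero_or_pos k with rfl | hk0
    · simpa using hM
    refine le_trans (le_of_eq ?_) (h.sum_le n (posFloor n θ + 1 + a) (k - 1) (by omega)
      (by omega))
    refine Finset.sum_congr rfl fun i hi => ?_
    rw [sub_sub_sub_cancel_right]
    congr 4 <;> ring

/-- Three errors of size `ε/3`: `J` is chosen from `M`, then `η` from `J`, and finally `n` large for
the term `w n (1 + log n)` and for the `J` nearest nodes to lie within the radius of continuity. -/
theorem Admissible.tendstoUniformlyOn {f : ℝ → ℝ} (hf : Admissible f) {K : Set ℝ}
    (hK : IsCompact K) (hK1 : K ⊆ Set.Ioo (-1) 1) (hfK : ∀ x ∈ K, ContinuousAt f x) :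
    TendstoUniformlyOn (fun n : ℕ => lagrangeOp n f) f atTop K := by
  obtain ⟨M, w, h⟩ := hf
  have hM := h.bound_nonneg
  rw [Metric.tendstoUniformlyOn_iff]
  intro ε hε
  obtain ⟨J, hJ⟩ : ∃ J : ℕ, 2 * (2 * (3 * M) / ((J : ℝ) + 1)) < ε / 3 := by
    obtain ⟨J, hJ⟩ := exists_nat_gt (36 * M / ε)
    refine ⟨J, ?_⟩
    rw [div_lt_iff₀ hε] at hJ
    rw [← mul_div_assoc, div_lt_iff₀ (by positivity)]
    nlinarith
  set η := ε / (12 * (J + 1)) with hηdef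
  have hη : 0 < η := by positivity
  have hηJ : 2 * (2 * J * η) ≤ ε / 3 := by
    rw [hηdef]
    have : 2 * (2 * (J : ℝ) * (ε / (12 * (J + 1)))) = ε / 3 * (J / (J + 1)) := by
      field_simp; ring
    rw [this]
    exact mul_le_of_le_one_right (by positivity) (div_le_one_of_le₀ (by linarith) (by positivity))
  -- The nodes need not lie in `K`: `δ` is uniform for `x ∈ K` and arbitrary `y`, which uses
  -- continuity at the points of `K` and not merely on `K`.
  have huc := hK.uniformContinuousAt_of_continuousAt f hfK (Metric.dist_mem_uniformity hη)
  obtain ⟨δ, hδ, hδf⟩ := Metric.mem_uniformity_dist.mp huc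
  have hlim : Tendsto (fun n : ℕ => Real.pi / (n : ℝ) * (J + 1)) atTop (𝓝 0) := by
    simpa using (tendsto_const_div_atTop_nhds_zero_nat Real.pi).mul_const ((J : ℝ) + 1)
  have hw : Tendsto (fun n : ℕ => 4 * (w n * (1 + Real.log n))) atTop (𝓝 0) := by
    simpa using h.tendsto.const_mul 4
  filter_upwards [eventually_gt_atTop 0, hlim.eventually_lt_const hδ,
    hw.eventually_lt_const (show 0 < ε / 3 by positivity)] with n hn hn1 hn2 x hx
  have hx1 := hK1 hx
  have hcos := Real.cos_arccos hx1.1.le hx1.2.le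
  have key := h.abs_lagrangeOp_sub_le hn (Real.arccos_pos.mpr hx1.2) (Real.arccos_lt_pi.mpr hx1.1)
    (J := J) hη.le (fun y hy => ?_)
  · rw [hcos] at key
    rw [dist_comm, Real.dist_eq]
    linarith
  · rw [hcos] at hy ⊢
    have := hδf (a := x) (b := y) (by rw [dist_comm, Real.dist_eq]; linarith) hx
    rw [abs_sub_comm]
    exact (le_of_lt this)

/-! ### The limit function -/

/-- Abel's inequality with `M = 1` and `w = 0`, since the partial sums of `(-1)^i` are `0` or `1`.
-/
theorem abs_alternating_antitone_sum_le {c : ℕ → ℝ} (hc : Antitone c) (hc0 : ∀ i, 0 ≤ c i)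
    (m : ℕ) : |∑ i ∈ Finset.range m, (-1) ^ i * c i| ≤ c 0 := by
  have h := abs_sum_mul_le_of_antitone (s := fun i => (-1) ^ i) hc hc0 (m := m) (M := 1) (w := 0)
    fun k _ => by
      rw [neg_one_geom_sum]
      split_ifs <;> simp
  simpa [mul_comm] using h

theorem tendsto_lerchJ {t : ℝ} (ht : 0 < t) :
    Tendsto (fun m : ℕ => ∑ i ∈ Finset.range m, (-1 : ℝ) ^ i / (i + t)) atTop
      (𝓝 (lerchJ 1 t)) := by
  have h := (summable_lerchJ one_pos ht).hasSum
  rw [HasSum, SummationFilter.conditional_filter_eq_map_range, tendsto_map'_iff] at h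
  simpa [Function.comp_def, lerchJ] using h

/-- The absolute value of the terms of the series defining `gFun t`. -/
def gTerm (t : ℝ) (i : ℕ) : ℝ :=
  Real.sin (Real.pi * t) / (Real.pi * (i + t))

theorem tendsto_gFun {t : ℝ} (ht : 0 < t) :
    Tendsto (fun m : ℕ => ∑ i ∈ Finset.range m, (-1) ^ i * gTerm t i) atTop (𝓝 (gFun t)) := by
  have h := (tendsto_lerchJ ht).const_mul (Real.sin (Real.pi * t) / Real.pi)
  refine h.congr fun m => ?_
  rw [Finset.mul_sum]
  refine Finset.sum_congr rfl fun i _ => ?_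
  have : (i : ℝ) + t ≠ 0 := by positivity
  have := Real.pi_pos.ne'
  unfold gTerm
  field_simp

section
variable {t : ℝ}

theorem sin_pi_mul_pos (ht : t ∈ Set.Ioo (0 : ℝ) 1) : 0 < Real.sin (Real.pi * t) := by
  have := Real.pi_pos
  exact Real.sin_pos_of_pos_of_lt_pi (mul_pos this ht.1) (by nlinarith [ht.2])

theorem gTerm_nonneg (ht : t ∈ Set.Ioo (0 : ℝ) 1) (i : ℕ) : 0 ≤ gTerm t i := by
  have := sin_pi_mul_pos ht
  have := ht.1
  have := Real.pi_pos
  unfold gTerm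
  positivity

theorem gTerm_antitone (ht : t ∈ Set.Ioo (0 : ℝ) 1) : Antitone (gTerm t) := by
  intro i j hij
  have := sin_pi_mul_pos ht
  have := ht.1
  have := Real.pi_pos
  have : (i : ℝ) ≤ j := by exact_mod_cast hij
  unfold gTerm
  gcongr

theorem gTerm_le (ht : t ∈ Set.Ioo (0 : ℝ) 1) (i : ℕ) : gTerm t i ≤ 1 / (i + 1) := by
  have hpi := Real.pi_gt_three
  have h0 := ht.1
  have h1 : Real.sin (Real.pi * t) ≤ Real.pi * t := Real.sin_le (by positivity)
  have h2 := Real.sin_le_one (Real.pi * t)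
  unfold gTerm
  rw [div_le_div_iff₀ (by positivity) (by positivity)]
  have : Real.sin (Real.pi * t) * i ≤ Real.pi * i := by gcongr; linarith
  linarith

/-- The tail of an alternating series is at most its first omitted term. By `gTerm_le` the bound
does not depend on `t`, which yields continuity of `gFun` and later the uniform comparison with the
weights. -/
theorem abs_sum_gTerm_sub_gFun_le (ht : t ∈ Set.Ioo (0 : ℝ) 1) (J : ℕ) :
    |∑ i ∈ Finset.range J, (-1) ^ i * gTerm t i - gFun t| ≤ 1 / (J + 1) := by
  have h1 := (tendsto_gFun ht.1).comp (tendsto_add_atTop_nat J)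
  refine le_of_tendsto ((h1.const_sub _).abs) (Eventually.of_forall fun m => ?_)
  simp only [Function.comp_apply]
  rw [add_comm m J, Finset.sum_range_add, sub_add_cancel_left, abs_neg]
  have h2 : ∑ i ∈ Finset.range m, (-1) ^ (J + i) * gTerm t (J + i) =
      (-1) ^ J * ∑ i ∈ Finset.range m, (-1) ^ i * gTerm t (J + i) := by
    rw [Finset.mul_sum]
    exact Finset.sum_congr rfl fun i _ => by rw [pow_add]; ring
  rw [h2, abs_mul, abs_pow, abs_neg, abs_one, one_pow, one_mul]
  exact (abs_alternating_antitone_sum_le (c := fun i => gTerm t (J + i))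
    (fun i j hij => gTerm_antitone ht (by omega)) (fun i => gTerm_nonneg ht _) m).trans
    (gTerm_le ht J)

end

theorem continuousOn_gFun : ContinuousOn gFun (Set.Ioo 0 1) := by
  have h : TendstoUniformlyOn (fun (J : ℕ) t => ∑ i ∈ Finset.range J, (-1) ^ i * gTerm t i) gFun
      atTop (Set.Ioo 0 1) := by
    rw [Metric.tendstoUniformlyOn_iff]
    intro ε hε
    filter_upwards [tendsto_one_div_add_atTop_nhds_zero_nat.eventually_lt_const hε] with J hJ t ht
    rw [dist_comm, Real.dist_eq]
    exact (abs_sum_gTerm_sub_gFun_le ht J).trans_lt hJ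
  refine h.continuousOn (Frequently.of_forall fun J => ?_)
  refine continuousOn_finsetSum _ fun i _ => continuousOn_const.mul ?_
  refine ContinuousOn.div (by fun_prop) (by fun_prop) fun t ht => ?_
  have := ht.1
  have := Real.pi_pos
  positivity

/-! ### Reflection formula and strict monotonicity of the limit function -/

theorem mem_integerComplement_of_mem_Ioo {t : ℝ} (ht : t ∈ Set.Ioo (0 : ℝ) 1) :
    (t : ℂ) ∈ Complex.integerComplement := by
  rintro ⟨k, hk⟩
  have h : (k : ℝ) = t := by exact_mod_cast hk
  have h0 : 0 < k := by exact_mod_cast h ▸ ht.1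
  have h1 : k < 1 := by exact_mod_cast h ▸ ht.2
  omega

/-- The finite form of `π cot(πt/2) - π cot(πt) = π / sin(πt)`. The terms of `t/2` are twice the
terms of `t` with poles at even integers, so the difference gives sign `+` to even poles and `-` to
odd ones. The two alternating sums have lengths `2N+1` and `2N` because the pole at `0` is unpaired.
-/
theorem sum_cotTerm_half (t : ℂ) (N : ℕ) :
    ∑ j ∈ Finset.range (2 * N + 1), (-1) ^ j / (j + t) +
        ∑ j ∈ Finset.range (2 * N), (-1) ^ j / (j + (1 - t)) =
      1 / t + (∑ j ∈ Finset.range N, cotTerm (t / 2) j -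
        ∑ j ∈ Finset.range (2 * N), cotTerm t j) := by
  induction N with
  | zero => simp
  | succ N ih =>
    rw [show 2 * (N + 1) + 1 = 2 * N + 1 + 1 + 1 by ring, show 2 * (N + 1) = 2 * N + 1 + 1 by ring]
    simp only [Finset.sum_range_succ _ (2 * N + 1 + 1), Finset.sum_range_succ _ (2 * N + 1),
      Finset.sum_range_succ _ N]
    rw [Finset.sum_range_succ (fun j => (-1) ^ j / ((j : ℂ) + (1 - t))) (2 * N),
      Finset.sum_range_succ (fun j => cotTerm t j) (2 * N)]
    have e1 : cotTerm (t / 2) N = 2 * (1 / (t - (2 * N + 2)) + 1 / (t + (2 * N + 2))) := by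
      rw [cotTerm, show t / 2 - ((N : ℂ) + 1) = (t - (2 * N + 2)) / 2 by ring,
        show t / 2 + ((N : ℂ) + 1) = (t + (2 * N + 2)) / 2 by ring, one_div_div, one_div_div]
      ring
    have e2 : (-1 : ℂ) ^ (2 * N) = 1 := by rw [pow_mul]; simp
    have e3 : (-1 : ℂ) ^ (2 * N) / (((2 * N : ℕ) : ℂ) + (1 - t)) = -(1 / (t - (2 * N + 1))) := by
      rw [e2, ← div_neg]; congr 1; push_cast; ring
    have e4 : (-1 : ℂ) ^ (2 * N + 1) / (((2 * N + 1 : ℕ) : ℂ) + (1 - t)) =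
        1 / (t - (2 * N + 2)) := by
      rw [pow_succ, e2, one_mul, neg_div, ← div_neg]; congr 1; push_cast; ring
    have e5 : (-1 : ℂ) ^ (2 * N + 1 + 1) / (((2 * N + 1 + 1 : ℕ) : ℂ) + t) =
        1 / (t + (2 * N + 2)) := by
      rw [pow_succ, pow_succ, e2]; congr 1 <;> push_cast <;> ring
    have e6 : (-1 : ℂ) ^ (2 * N + 1) / (((2 * N + 1 : ℕ) : ℂ) + t) = -(1 / (t + (2 * N + 1))) := by
      rw [pow_succ, e2, one_mul, neg_div]; congr 2; push_cast; ring
    have e7 : cotTerm t (2 * N) = 1 / (t - (2 * N + 1)) + 1 / (t + (2 * N + 1)) := by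
      simp [cotTerm]
    have e8 : cotTerm t (2 * N + 1) = 1 / (t - (2 * N + 2)) + 1 / (t + (2 * N + 2)) := by
      rw [cotTerm]; push_cast; ring_nf
    rw [e1, e3, e4, e5, e6, e7, e8]
    linear_combination ih

/-- The reflection formula, which amounts to the partial fraction expansion of `π / sin (π t)`. -/
theorem gFun_add_gFun_one_sub {t : ℝ} (ht : t ∈ Set.Ioo (0 : ℝ) 1) :
    gFun t + gFun (1 - t) = 1 := by
  have ht2 : t / 2 ∈ Set.Ioo (0 : ℝ) 1 := ⟨by linarith [ht.1], by linarith [ht.2]⟩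
  have hs := (sin_pi_mul_pos ht).ne'
  have hs2 := (sin_pi_mul_pos ht2).ne'
  have ht0 : (t : ℂ) ≠ 0 := by exact_mod_cast ht.1.ne'
  have h2 : Tendsto (fun N : ℕ => 2 * N) atTop atTop :=
    tendsto_id.const_mul_atTop' (by norm_num : 0 < 2)
  have h1 := (tendsto_logDeriv_euler_cot_sub (mem_integerComplement_of_mem_Ioo ht2)).sub
    ((tendsto_logDeriv_euler_cot_sub (mem_integerComplement_of_mem_Ioo ht)).comp h2)
  have h3 : Tendsto (fun N : ℕ => ((∑ j ∈ Finset.range (2 * N + 1), (-1 : ℝ) ^ j / (j + t) +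
      ∑ j ∈ Finset.range (2 * N), (-1) ^ j / (j + (1 - t)) : ℝ) : ℂ)) atTop
      (𝓝 ((Real.pi / Real.sin (Real.pi * t) : ℝ) : ℂ)) := by
    have h4 := h1.const_add (1 / (t : ℂ))
    have hlim : 1 / (t : ℂ) + (Real.pi * Complex.cot (Real.pi * ((t / 2 : ℝ) : ℂ)) -
        1 / ((t / 2 : ℝ) : ℂ) - (Real.pi * Complex.cot (Real.pi * (t : ℂ)) - 1 / (t : ℂ))) =
        ((Real.pi / Real.sin (Real.pi * t) : ℝ) : ℂ) := by
      -- `cot x - cot 2x = 1 / sin 2x` with `x = πt/2`.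
      have e1 : Real.pi * Real.cot (Real.pi * (t / 2)) - Real.pi * Real.cot (Real.pi * t) =
          Real.pi / Real.sin (Real.pi * t) := by
        have d : Real.pi * t = 2 * (Real.pi * (t / 2)) := by ring
        rw [Real.cot_eq_cos_div_sin, Real.cot_eq_cos_div_sin]
        have hs' := hs
        rw [d, Real.sin_two_mul] at hs'
        have hc2 : Real.cos (Real.pi * (t / 2)) ≠ 0 := right_ne_zero_of_mul hs'
        rw [d, Real.sin_two_mul, Real.cos_two_mul]
        field_simp
        ring
      rw [← e1]
      push_cast
      field_simp
      ring
    rw [hlim] at h4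
    refine h4.congr fun N => ?_
    have := sum_cotTerm_half (t : ℂ) N
    push_cast
    rw [this]
    simp
  have h5 : Tendsto (fun N : ℕ => ∑ j ∈ Finset.range (2 * N + 1), (-1 : ℝ) ^ j / (j + t) +
      ∑ j ∈ Finset.range (2 * N), (-1) ^ j / (j + (1 - t))) atTop
      (𝓝 (Real.pi / Real.sin (Real.pi * t))) := by
    have := (Complex.continuous_re.tendsto _).comp h3
    simpa only [Function.comp_def, Complex.ofReal_re] using this
  have h6 : Tendsto (fun N : ℕ => ∑ j ∈ Finset.range (2 * N + 1), (-1 : ℝ) ^ j / (j + t) +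
      ∑ j ∈ Finset.range (2 * N), (-1) ^ j / (j + (1 - t))) atTop
      (𝓝 (lerchJ 1 t + lerchJ 1 (1 - t))) :=
    ((tendsto_lerchJ ht.1).comp ((tendsto_add_atTop_nat 1).comp h2)).add
      ((tendsto_lerchJ (sub_pos.mpr ht.2)).comp h2)
  have h7 := tendsto_nhds_unique h6 h5
  have h8 : Real.sin (Real.pi * (1 - t)) = Real.sin (Real.pi * t) := by
    rw [mul_sub, mul_one, Real.sin_pi_sub]
  rw [gFun, gFun, h8, ← mul_add, h7]
  have := Real.pi_pos.ne'
  field_simp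

/-- Consecutive terms are grouped in pairs. Every pair is nonincreasing in the parameter, and the
first pair alone gives the bound, hence the induction starts from one pair. -/
theorem lerchJ_one_sub_ge {s t : ℝ} (hs : 1 / 2 ≤ s) (hst : s ≤ t) (ht : t < 1) :
    (t - s) / 2 ≤ lerchJ 1 s - lerchJ 1 t := by
  have hs0 : 0 < s := by linarith
  have ht0 : 0 < t := by linarith
  have h2 : Tendsto (fun N : ℕ => 2 * (N + 1)) atTop atTop :=
    (tendsto_add_atTop_nat 1).const_mul_atTop' (by norm_num : 0 < 2)
  refine ge_of_tendsto (((tendsto_lerchJ hs0).comp h2).sub ((tendsto_lerchJ ht0).comp h2))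
    (Eventually.of_forall fun N => ?_)
  simp only [Function.comp_apply]
  induction N with
  | zero =>
    norm_num [Finset.sum_range_succ]
    have e : s⁻¹ + -1 / (1 + s) - (t⁻¹ + -1 / (1 + t)) =
        (t - s) * (1 / (s * t) - 1 / ((1 + s) * (1 + t))) := by
      field_simp
      ring
    rw [e, div_eq_mul_one_div]
    refine mul_le_mul_of_nonneg_left ?_ (by linarith)
    -- The factor is at least `1 - 1/2`: `st ≤ 1`, while `(1+s)(1+t) ≥ 9/4 ≥ 2` because `s, t ≥
    -- 1/2`.
    have h3 : 1 ≤ 1 / (s * t) := by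
      rw [le_div_iff₀ (by positivity)]
      nlinarith
    have h4 : 1 / ((1 + s) * (1 + t)) ≤ 1 / 2 := by
      apply one_div_le_one_div_of_le (by norm_num)
      nlinarith
    linarith
  | succ N ih =>
    rw [show 2 * (N + 1 + 1) = 2 * (N + 1) + 1 + 1 by ring]
    simp only [Finset.sum_range_succ _ (2 * (N + 1) + 1), Finset.sum_range_succ _ (2 * (N + 1))]
    have e2 : (-1 : ℝ) ^ (2 * (N + 1)) = 1 := by rw [pow_mul]; simp
    rw [pow_succ, e2]
    set a : ℝ := ((2 * (N + 1) : ℕ) : ℝ) with ha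
    have ha0 : 0 ≤ a := by positivity
    have e3 : ((2 * (N + 1) + 1 : ℕ) : ℝ) = a + 1 := by push_cast; rw [ha]; push_cast; ring
    rw [e3]
    have e4 : 1 / (a + s) + 1 * -1 / (a + 1 + s) - (1 / (a + t) + 1 * -1 / (a + 1 + t)) =
        (t - s) * (1 / ((a + s) * (a + t)) - 1 / ((a + 1 + s) * (a + 1 + t))) := by
      field_simp
      ring
    have e5 : 1 / ((a + 1 + s) * (a + 1 + t)) ≤ 1 / ((a + s) * (a + t)) := by
      apply one_div_le_one_div_of_le (by positivity)
      nlinarith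
    have e6 := mul_nonneg (sub_nonneg.mpr hst) (sub_nonneg.mpr e5)
    linarith

theorem lerchJ_one_nonneg {t : ℝ} (ht : t ∈ Set.Ioo (0 : ℝ) 1) : 0 ≤ lerchJ 1 t := by
  have ht0 := ht.1
  have h2 : Tendsto (fun N : ℕ => 2 * N) atTop atTop :=
    tendsto_id.const_mul_atTop' (by norm_num : 0 < 2)
  refine ge_of_tendsto ((tendsto_lerchJ ht0).comp h2) (Eventually.of_forall fun N => ?_)
  simp only [Function.comp_apply]
  induction N with
  | zero => simp
  | succ N ih =>
    rw [show 2 * (N + 1) = 2 * N + 1 + 1 by ring, Finset.sum_range_succ, Finset.sum_range_succ]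
    have e2 : (-1 : ℝ) ^ (2 * N) = 1 := by rw [pow_mul]; simp
    rw [pow_succ, e2]
    push_cast
    have : 1 / (2 * (N : ℝ) + 1 + t) ≤ 1 / (2 * N + t) :=
      one_div_le_one_div_of_le (by positivity) (by linarith)
    have e3 : 1 * -1 / (2 * (N : ℝ) + 1 + t) = -(1 / (2 * (N : ℝ) + 1 + t)) := by ring
    rw [e3]
    linarith

/-- On `[1/2, 1[` both factors `sin(πt)` and `J(1,t)` are nonnegative and decreasing; the decrease
of `J` alone, weighted by `sin(πt) ≥ c`, is enough. -/
theorem gFun_sub_ge_of_half_le {s t c : ℝ} (hs : 1 / 2 ≤ s) (hst : s ≤ t) (ht : t < 1)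
    (hc : c ≤ Real.sin (Real.pi * t)) :
    c / (2 * Real.pi) * (t - s) ≤ gFun s - gFun t := by
  have hpi := Real.pi_pos
  have hsin : Real.sin (Real.pi * t) ≤ Real.sin (Real.pi * s) := by
    rw [← Real.sin_pi_sub, ← Real.sin_pi_sub (Real.pi * s)]
    apply Real.sin_le_sin_of_le_of_le_pi_div_two <;> nlinarith
  have ht1 : t ∈ Set.Ioo (0 : ℝ) 1 := ⟨by linarith, ht⟩
  have hs1 : s ∈ Set.Ioo (0 : ℝ) 1 := ⟨by linarith, by linarith⟩
  have h1 := lerchJ_one_sub_ge hs hst ht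
  have h2 := lerchJ_one_nonneg hs1
  have h3 := sin_pi_mul_pos ht1
  have h4 : Real.sin (Real.pi * t) * lerchJ 1 s ≤ Real.sin (Real.pi * s) * lerchJ 1 s := by gcongr
  have h5 : Real.sin (Real.pi * t) * ((t - s) / 2) ≤
      Real.sin (Real.pi * t) * (lerchJ 1 s - lerchJ 1 t) := by gcongr
  have h6 : c * (t - s) ≤ Real.sin (Real.pi * t) * (t - s) :=
    mul_le_mul_of_nonneg_right hc (by linarith)
  have e : gFun s - gFun t = (Real.sin (Real.pi * s) * lerchJ 1 s -
      Real.sin (Real.pi * t) * lerchJ 1 t) / Real.pi := by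
    unfold gFun; ring
  rw [e, le_div_iff₀ hpi]
  have e2 : c / (2 * Real.pi) * (t - s) * Real.pi = c * (t - s) / 2 := by field_simp
  rw [e2]
  linarith

/-- A quantitative form of the strict monotonicity of `gFun`. -/
theorem gFun_sub_ge {s t c : ℝ} (hs : 0 < s) (hst : s ≤ t) (ht : t < 1)
    (hcs : c ≤ Real.sin (Real.pi * s)) (hct : c ≤ Real.sin (Real.pi * t)) :
    c / (2 * Real.pi) * (t - s) ≤ gFun s - gFun t := by
  have left : ∀ s t : ℝ, 0 < s → s ≤ t → t ≤ 1 / 2 → c ≤ Real.sin (Real.pi * s) →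
      c / (2 * Real.pi) * (t - s) ≤ gFun s - gFun t := by
    intro s t hs hst ht hc
    -- The reflection formula carries the left half of the interval to the right half.
    have h := gFun_sub_ge_of_half_le (s := 1 - t) (t := 1 - s) (c := c) (by linarith) (by linarith)
      (by linarith) (by rwa [mul_sub, mul_one, Real.sin_pi_sub])
    have h1 := gFun_add_gFun_one_sub (t := s) ⟨hs, by linarith⟩
    have h2 := gFun_add_gFun_one_sub (t := t) ⟨by linarith, by linarith⟩
    rw [show 1 - s - (1 - t) = t - s by ring] at h
    linarith
  rcases le_total t (1 / 2) with h | h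
  · exact left s t hs hst h hcs
  rcases le_total (1 / 2) s with h' | h'
  · exact gFun_sub_ge_of_half_le h' hst ht hct
  · have h1 := left s (1 / 2) hs h' le_rfl hcs
    have h2 := gFun_sub_ge_of_half_le le_rfl h ht hct
    linarith

theorem gFun_strictAntiOn : StrictAntiOn gFun (Set.Ioo 0 1) := by
  intro s hs t ht hst
  have h := gFun_sub_ge (c := min (Real.sin (Real.pi * s)) (Real.sin (Real.pi * t))) hs.1 hst.le
    ht.2 (min_le_left _ _) (min_le_right _ _)
  have h1 : 0 < min (Real.sin (Real.pi * s)) (Real.sin (Real.pi * t)) :=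
    lt_min (sin_pi_mul_pos hs) (sin_pi_mul_pos ht)
  have h2 : 0 < min (Real.sin (Real.pi * s)) (Real.sin (Real.pi * t)) / (2 * Real.pi) * (t - s) :=
    mul_pos (div_pos h1 (by have := Real.pi_pos; positivity)) (by linarith)
  linarith

theorem gJump_injOn {a b : ℝ} (hab : a ≠ b) : Set.InjOn (gJump a b) (Set.Ioo 0 1) := by
  intro s hs t ht h
  have h1 : (b - a) * gFun s = (b - a) * gFun t := by
    unfold gJump at h; linarith
  exact gFun_strictAntiOn.injOn hs ht (mul_left_cancel₀ (sub_ne_zero.mpr hab.symm) h1)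

theorem continuousOn_gJump (a b : ℝ) : ContinuousOn (gJump a b) (Set.Ioo 0 1) :=
  continuousOn_const.add (continuousOn_const.mul continuousOn_gFun)

theorem abs_gFun_sub_ge {s t c : ℝ} (hs : s ∈ Set.Ioo (0 : ℝ) 1) (ht : t ∈ Set.Ioo (0 : ℝ) 1)
    (hcs : c ≤ Real.sin (Real.pi * s)) (hct : c ≤ Real.sin (Real.pi * t)) :
    c / (2 * Real.pi) * |s - t| ≤ |gFun s - gFun t| := by
  rcases le_total s t with h | h
  · rw [abs_sub_comm, abs_of_nonneg (sub_nonneg.mpr h)]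
    exact (gFun_sub_ge hs.1 h ht.2 hcs hct).trans (le_abs_self _)
  · rw [abs_of_nonneg (sub_nonneg.mpr h), abs_sub_comm]
    exact (gFun_sub_ge ht.1 h hs.2 hct hcs).trans (le_abs_self _)

/-- The preimage of a null set under `gJump a b` is a null set. -/
theorem volume_gJump_preimage_eq_zero {a b : ℝ} (hab : a ≠ b) {E : Set ℝ} (hE : volume E = 0) :
    volume {t ∈ Set.Ioo (0 : ℝ) 1 | gJump a b t ∈ E} = 0 := by
  have hpi := Real.pi_pos
  have hba : 0 < |b - a| := abs_pos.mpr (sub_ne_zero.mpr hab.symm)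
  -- The lower Lipschitz constant degenerates at the endpoints, so the interval is exhausted by the
  -- sets where `sin(πt) ≥ 1/(k+1)`. On each of them the inverse of `gJump a b` is Lipschitz.
  have hsub : {t ∈ Set.Ioo (0 : ℝ) 1 | gJump a b t ∈ E} ⊆
      ⋃ k : ℕ, {t ∈ Set.Ioo (0 : ℝ) 1 | 1 / ((k : ℝ) + 1) ≤ Real.sin (Real.pi * t) ∧
        gJump a b t ∈ E} := by
    rintro t ⟨ht, htE⟩
    obtain ⟨k, hk⟩ := exists_nat_one_div_lt (sin_pi_mul_pos ht)
    exact Set.mem_iUnion.mpr ⟨k, ht, hk.le, htE⟩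
  refine measure_mono_null hsub (measure_iUnion_null fun k => ?_)
  set S := {t ∈ Set.Ioo (0 : ℝ) 1 | 1 / ((k : ℝ) + 1) ≤ Real.sin (Real.pi * t) ∧
    gJump a b t ∈ E} with hS
  have hinj : Set.InjOn (gJump a b) S := (gJump_injOn hab).mono fun t ht => ht.1
  set c : ℝ := 1 / ((k : ℝ) + 1) / (2 * Real.pi) * |b - a| with hc
  have hc0 : 0 < c := by positivity
  have hlip : LipschitzOnWith (Real.toNNReal c⁻¹) (Function.invFunOn (gJump a b) S)
      (gJump a b '' S) := by
    refine LipschitzOnWith.of_dist_le_mul ?_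
    rintro _ ⟨s, hs, rfl⟩ _ ⟨t, ht, rfl⟩
    rw [hinj.leftInvOn_invFunOn hs, hinj.leftInvOn_invFunOn ht, Real.coe_toNNReal _ (by positivity),
      Real.dist_eq, Real.dist_eq, le_inv_mul_iff₀ hc0]
    have h1 := abs_gFun_sub_ge hs.1 ht.1 hs.2.1 ht.2.1
    have h2 : gJump a b s - gJump a b t = (b - a) * (gFun s - gFun t) := by unfold gJump; ring
    rw [h2, abs_mul, hc]
    nlinarith [mul_le_mul_of_nonneg_left h1 hba.le]
  have h3 : S ⊆ Function.invFunOn (gJump a b) S '' (gJump a b '' S) := by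
    intro t ht
    exact ⟨_, ⟨t, ht, rfl⟩, hinj.leftInvOn_invFunOn ht⟩
  have h4 : volume (gJump a b '' S) = 0 := by
    refine measure_mono_null ?_ hE
    rintro _ ⟨t, ht, rfl⟩
    exact ht.2.2
  -- A Lipschitz map sends null sets to null sets, one-dimensional Hausdorff measure being Lebesgue
  -- measure on the line.
  have h5 := hlip.hausdorffMeasure_image_le (d := 1) zero_le_one
  rw [hausdorffMeasure_real, h4, mul_zero] at h5
  exact measure_mono_null h3 (le_antisymm h5 zero_le)

/-! ### Asymptotics at a jump -/

/-- The product is `sin b` divided by minus the slope of the cosine between `θ` and `b`, and that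
slope tends to `-sin θ`. -/
theorem tendsto_sub_mul_kernel {θ : ℝ} (hθ : 0 < θ) (hθ' : θ < Real.pi) :
    Tendsto (fun b => (b - θ) * kernel θ b) (𝓝[≠] θ) (𝓝 1) := by
  have hs := (Real.sin_pos_of_pos_of_lt_pi hθ hθ').ne'
  have h1 := hasDerivAt_iff_tendsto_slope.mp (Real.hasDerivAt_cos θ)
  have h2 : Tendsto Real.sin (𝓝[≠] θ) (𝓝 (Real.sin θ)) :=
    (Real.continuous_sin.tendsto θ).mono_left nhdsWithin_le_nhds
  have h3 := h2.div h1.neg (by simpa using hs)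
  rw [neg_neg, div_self hs] at h3
  refine h3.congr' ?_
  filter_upwards [self_mem_nhdsWithin] with b hb
  have : b - θ ≠ 0 := sub_ne_zero.mpr hb
  rw [Pi.div_apply, kernel, slope_def_field, ← neg_div, neg_sub, div_div_eq_mul_div, mul_comm,
    mul_div_assoc]

theorem tendsto_pos {θ : ℝ} (hθ : 0 < θ) : Tendsto (fun n => pos n θ) atTop atTop := by
  have := Real.pi_pos
  unfold pos
  refine tendsto_atTop_add_const_right _ _ ?_
  simp_rw [mul_div_assoc]
  exact tendsto_natCast_atTop_atTop.atTop_mul_const (by positivity)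

theorem tendsto_posFloor {θ : ℝ} (hθ : 0 < θ) : Tendsto (fun n => posFloor n θ) atTop atTop :=
  tendsto_nat_floor_atTop.comp (tendsto_pos hθ)

theorem weightLeft_eq_gTerm_mul {n : ℕ} (hn : 0 < n) {θ : ℝ} (hθ : 0 < θ)
    (ht : 0 < posFract n θ) {j : ℕ} (hj : j < posFloor n θ) :
    weightLeft n θ j = gTerm (posFract n θ) j *
      ((angle n (posFloor n θ - j) - θ) * kernel θ (angle n (posFloor n θ - j))) := by
  have h := sub_angle_left hn hθ.le hj
  have hpi := Real.pi_pos.ne'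
  have hn' : (n : ℝ) ≠ 0 := by exact_mod_cast hn.ne'
  have : (j : ℝ) + posFract n θ ≠ 0 := by positivity
  rw [weightLeft, if_pos hj, gTerm, ← neg_sub θ, h]
  field_simp
  ring

/-- The sum of the fundamental polynomials at the nodes to the left of `θ` is asymptotic to
`gFun`, evaluated at the fractional part of the position. -/
theorem eventually_abs_sum_weightLeft_sub_gFun_lt {θ : ℝ} (hθ : 0 < θ) (hθ' : θ < Real.pi)
    {ε : ℝ} (hε : 0 < ε) :
    ∀ᶠ n : ℕ in atTop, 0 < posFract n θ →
      |∑ j ∈ Finset.range (posFloor n θ), (-1) ^ j * weightLeft n θ j - gFun (posFract n θ)| < ε := by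
  have hpi := Real.pi_pos
  -- The tail of the weights is at most `2/(J+1) < ε/3`, that of the series `1/(J+1) < ε/6`, and the
  -- first `J` terms differ by at most `ε/3` in total.
  obtain ⟨J, hJ⟩ := exists_nat_one_div_lt (show 0 < ε / 6 by positivity)
  obtain ⟨δ, hδ, hker⟩ := Metric.mem_nhdsWithin_iff.mp
    ((tendsto_sub_mul_kernel hθ hθ').eventually (Metric.ball_mem_nhds 1
      (show 0 < ε / (3 * (J + 1)) by positivity)))
  have hlim : Tendsto (fun n : ℕ => Real.pi / (n : ℝ) * (J + 1)) atTop (𝓝 0) := by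
    simpa using (tendsto_const_div_atTop_nhds_zero_nat Real.pi).mul_const ((J : ℝ) + 1)
  filter_upwards [eventually_gt_atTop 0, hlim.eventually_lt_const hδ,
    (tendsto_posFloor hθ).eventually_ge_atTop J] with n hn hnδ hJk ht
  have htm : posFract n θ ∈ Set.Ioo (0 : ℝ) 1 := ⟨ht, posFract_lt_one n θ⟩
  set t := posFract n θ with htdef
  obtain ⟨r, hr⟩ := Nat.exists_eq_add_of_le hJk
  have hnear : |∑ j ∈ Finset.range J, (-1) ^ j * weightLeft n θ j -
      ∑ j ∈ Finset.range J, (-1) ^ j * gTerm t j| ≤ ε / 3 := by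
    rw [← Finset.sum_sub_distrib]
    have : ∀ j ∈ Finset.range J, |(-1) ^ j * weightLeft n θ j - (-1) ^ j * gTerm t j| ≤
        ε / (3 * (J + 1)) := by
      intro j hj
      rw [Finset.mem_range] at hj
      have hjk : j < posFloor n θ := by omega
      have hlt := angle_left_lt hn hθ ht hjk
      have hdist : angle n (posFloor n θ - j) ∈ Metric.ball θ δ := by
        rw [Metric.mem_ball, dist_comm, Real.dist_eq, sub_angle_left hn hθ.le hjk,
          abs_of_nonneg (by positivity)]
        refine lt_of_le_of_lt ?_ hnδ
        have : (j : ℝ) ≤ J := by exact_mod_cast hj.le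
        exact mul_le_mul_of_nonneg_left (by linarith [htm.2]) (by positivity)
      have hk : dist _ _ < _ := hker ⟨hdist, hlt.ne⟩
      rw [Real.dist_eq] at hk
      rw [weightLeft_eq_gTerm_mul hn hθ ht hjk, ← mul_sub, abs_mul, abs_pow, abs_neg, abs_one,
        one_pow, one_mul, ← htdef, ← mul_sub_one, abs_mul, abs_of_nonneg (gTerm_nonneg htm j)]
      refine (mul_le_of_le_one_left (abs_nonneg _) ?_).trans hk.le
      refine (gTerm_le htm j).trans ?_
      rw [div_le_one (by positivity)]
      linarith [(j.cast_nonneg : (0 : ℝ) ≤ j)]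
    refine (Finset.abs_sum_le_sum_abs _ _).trans ((Finset.sum_le_sum this).trans ?_)
    rw [Finset.sum_const, Finset.card_range, nsmul_eq_mul]
    have e : (J : ℝ) * (ε / (3 * (J + 1))) = ε / 3 * (J / (J + 1)) := by field_simp
    rw [e]
    exact mul_le_of_le_one_right (by positivity) (div_le_one_of_le₀ (by linarith) (by positivity))
  have hfar : |∑ j ∈ Finset.range r, (-1) ^ (J + j) * weightLeft n θ (J + j)| ≤ 2 / (J + 1) := by
    have h2 : ∑ i ∈ Finset.range r, (-1) ^ (J + i) * weightLeft n θ (J + i) =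
        (-1) ^ J * ∑ i ∈ Finset.range r, (-1) ^ i * weightLeft n θ (J + i) := by
      rw [Finset.mul_sum]
      exact Finset.sum_congr rfl fun i _ => by rw [pow_add]; ring
    rw [h2, abs_mul, abs_pow, abs_neg, abs_one, one_pow, one_mul]
    exact (abs_alternating_antitone_sum_le (c := fun i => weightLeft n θ (J + i))
      (fun i j hij => weightLeft_antitone hn hθ hθ' ht (by omega))
      (fun i => weightLeft_nonneg hn hθ hθ' ht _) r).trans (weightLeft_le hn hθ hθ' ht J)
  have hg := abs_sum_gTerm_sub_gFun_le htm J
  rw [hr, Finset.sum_range_add]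
  have e1 : (2 : ℝ) / (J + 1) = 2 * (1 / (J + 1)) := by ring
  rw [e1] at hfar
  rw [abs_le] at hnear hfar hg
  rw [abs_lt]
  constructor <;> linarith [hnear.1, hnear.2, hfar.1, hfar.2, hg.1, hg.2]

/-- The cosine reverses order, so nodes of smaller angle are those where the step equals `1`. The
value `d` plays no part, as no node falls on `cos θ`. -/
theorem lagrangeOp_stepFun {n : ℕ} (hn : 0 < n) {θ : ℝ} (hθ : 0 < θ) (hθ' : θ < Real.pi)
    (ht : 0 < posFract n θ) (d : ℝ) :
    lagrangeOp n (stepFun (Real.cos θ) d) (Real.cos θ) =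
      ∑ j ∈ Finset.range (posFloor n θ), (-1) ^ j * weightLeft n θ j := by
  have h := lagrangeOp_sub_eq hn hθ hθ' ht (stepFun (Real.cos θ) d) 0
  rw [sub_zero] at h
  rw [h]
  have h2 : ∑ j ∈ Finset.range (n - posFloor n θ), (-1) ^ j * (weightRight n θ j *
      (stepFun (Real.cos θ) d (node n (posFloor n θ + 1 + j)) - 0)) = 0 := by
    refine Finset.sum_eq_zero fun j hj => ?_
    rw [Finset.mem_range] at hj
    have : node n (posFloor n θ + 1 + j) < Real.cos θ := by
      rw [← sub_pos]
      exact cos_sub_cos_pos hθ (angle_lt_pi (right_mem_Icc hj)) (lt_angle_right hn hθ.le j)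
    simp [stepFun, this]
  rw [h2, add_zero]
  refine Finset.sum_congr rfl fun j hj => ?_
  rw [Finset.mem_range] at hj
  have : Real.cos θ < node n (posFloor n θ - j) := by
    rw [← sub_pos]
    exact cos_sub_cos_pos (angle_pos (left_mem_Icc hθ hθ' hj)) hθ' (angle_left_lt hn hθ ht hj)
  simp [stepFun, this.not_gt, this.ne']

/-- The sequence to which `lagrangeOp n f` is asymptotic at the point `cos θ` of discontinuity. -/
def jumpValue (a b d θ : ℝ) (n : ℕ) : ℝ :=
  if posFract n θ = 0 then d else gJump a b (posFract n θ)

/-- Writing `f = f₁ + (b - a) h` with `h` a step reduces the jump to that of `h`: uniform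
convergence on the one-point compact set handles `f₁`, and the weight asymptotics handle `h`. -/
theorem Admissible.tendsto_lagrangeOp_sub_jumpValue {f : ℝ → ℝ} (hf : Admissible f) {θ a b : ℝ}
    (hθ : 0 < θ) (hθ' : θ < Real.pi) (ha : Tendsto f (𝓝[<] (Real.cos θ)) (𝓝 a))
    (hb : Tendsto f (𝓝[>] (Real.cos θ)) (𝓝 b)) (hab : a ≠ b) :
    Tendsto (fun n : ℕ => lagrangeOp n f (Real.cos θ) - jumpValue a b (f (Real.cos θ)) θ n) atTop
      (𝓝 0) := by
  set x₀ := Real.cos θ with hx₀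
  have hx1 : x₀ ∈ Set.Ioo (-1 : ℝ) 1 := by
    constructor
    · rw [hx₀, ← Real.cos_pi]
      exact Real.cos_lt_cos_of_nonneg_of_le_pi hθ.le le_rfl hθ'
    · rw [hx₀, ← Real.cos_zero]
      exact Real.cos_lt_cos_of_nonneg_of_le_pi le_rfl hθ'.le hθ
  have hba : b - a ≠ 0 := sub_ne_zero.mpr hab.symm
  -- The solution of `f x₀ - (b - a) d = a`, which makes `f₁` continuous at `x₀`.
  set d := (f x₀ - a) / (b - a) with hd
  set h := stepFun x₀ d with hh
  set f₁ := f + (-(b - a)) • h with hf₁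
  have hadm : Admissible f₁ := hf.add ((admissible_stepFun x₀ d).smul _)
  have hval : f₁ x₀ = a := by
    simp only [hf₁, hh, Pi.add_apply, Pi.smul_apply, smul_eq_mul, stepFun, lt_irrefl, if_false,
      if_true, hd]
    field_simp
    ring
  have hcont : ContinuousAt f₁ x₀ := by
    rw [continuousAt_iff_continuous_left'_right']
    constructor
    · rw [ContinuousWithinAt, hval]
      refine ha.congr' ?_
      filter_upwards [self_mem_nhdsWithin] with y hy
      simp [hf₁, hh, stepFun, Set.mem_Iio.mp hy]
    · rw [ContinuousWithinAt, hval]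
      have := hb.add_const (-(b - a))
      rw [show b + -(b - a) = a by ring] at this
      refine this.congr' ?_
      filter_upwards [self_mem_nhdsWithin] with y hy
      have hy' := Set.mem_Ioi.mp hy
      simp [hf₁, hh, stepFun, hy'.not_gt, hy'.ne']
  have hlim : Tendsto (fun n => lagrangeOp n f₁ x₀) atTop (𝓝 a) := by
    have := (hadm.tendstoUniformlyOn (K := {x₀}) isCompact_singleton (by simpa using hx1)
      (by simpa using hcont)).tendsto_at (Set.mem_singleton x₀)
    rwa [hval] at this
  have hsplit : ∀ n, lagrangeOp n f x₀ = lagrangeOp n f₁ x₀ + (b - a) * lagrangeOp n h x₀ := by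
    intro n
    rw [hf₁, lagrangeOp_add, lagrangeOp_smul]
    ring
  rw [Metric.tendsto_atTop'] at *
  intro ε hε
  obtain ⟨N, hN⟩ := hlim (ε / 2) (by positivity)
  have hba' : 0 < |b - a| := abs_pos.mpr hba
  obtain ⟨N', hN'⟩ := eventually_atTop.mp (eventually_abs_sum_weightLeft_sub_gFun_lt hθ hθ'
    (show 0 < ε / (2 * |b - a|) by positivity))
  refine ⟨max N N', fun n hn => ?_⟩
  have hn0 : 0 < n := by omega
  rw [Real.dist_eq, sub_zero, jumpValue]
  rcases (posFract_nonneg n θ).eq_or_lt with ht | ht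
  · rw [if_pos ht.symm]
    obtain ⟨hk, he⟩ := eq_node_of_posFract_eq_zero hn0 hθ hθ' ht.symm
    rw [← hx₀] at he
    rw [he, lagrangeOp_node hk, sub_self, abs_zero]
    exact hε
  · rw [if_neg ht.ne', hsplit, hh, hx₀, lagrangeOp_stepFun hn0 hθ hθ' ht, ← hx₀]
    have h1 := hN n (lt_of_le_of_lt (le_max_left _ _) hn)
    have h2 := hN' n (le_of_lt (lt_of_le_of_lt (le_max_right _ _) hn)) ht
    rw [Real.dist_eq] at h1
    rw [lt_div_iff₀ (by positivity)] at h2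
    rw [gJump]
    set s := ∑ j ∈ Finset.range (posFloor n θ), (-1) ^ j * weightLeft n θ j
    have e : lagrangeOp n f₁ x₀ + (b - a) * s - (a + (b - a) * gFun (posFract n θ)) =
        (lagrangeOp n f₁ x₀ - a) + (b - a) * (s - gFun (posFract n θ)) := by ring
    rw [e]
    refine (abs_add_le _ _).trans_lt ?_
    rw [abs_mul]
    linarith

/-! ### Densities -/

/-- The proportion of elements of `K` among `1, …, n`. -/
def ratio (K : Set ℕ) (n : ℕ) : ℝ :=
  ((K ∩ Set.Icc 1 n).ncard : ℝ) / n

/-- The set `K` of natural numbers has natural density `d`. -/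
def HasDensity (K : Set ℕ) (d : ℝ) : Prop :=
  Tendsto (ratio K) atTop (𝓝 d)

theorem ratio_nonneg (K : Set ℕ) (n : ℕ) : 0 ≤ ratio K n := by
  unfold ratio; positivity

theorem ratio_add_ratio_compl (K : Set ℕ) {n : ℕ} (hn : 0 < n) : ratio K n + ratio Kᶜ n = 1 := by
  have hn' : (n : ℝ) ≠ 0 := by exact_mod_cast hn.ne'
  have h := Set.ncard_inter_add_ncard_sdiff_eq_ncard (Set.Icc 1 n) K (Set.finite_Icc 1 n)
  have hcard : (Set.Icc 1 n).ncard = n := by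
    rw [Set.ncard_eq_toFinset_card']
    simp
  rw [Set.inter_comm, Set.sdiff_eq, Set.inter_comm _ Kᶜ, hcard] at h
  rw [ratio, ratio, ← add_div, div_eq_one_iff_eq hn']
  exact_mod_cast h

theorem ratio_le_one (K : Set ℕ) (n : ℕ) : ratio K n ≤ 1 := by
  rcases Nat.eq_zero_or_pos n with rfl | hn
  · simp [ratio]
  · linarith [ratio_add_ratio_compl K hn, ratio_nonneg Kᶜ n]

theorem ratio_mono {K K' : Set ℕ} (h : K ⊆ K') (n : ℕ) : ratio K n ≤ ratio K' n := by
  unfold ratio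
  gcongr
  exact (Set.finite_Icc 1 n).inter_of_right K'

theorem ratio_union_of_disjoint {K K' : Set ℕ} (h : Disjoint K K') (n : ℕ) :
    ratio (K ∪ K') n = ratio K n + ratio K' n := by
  rw [ratio, ratio, ratio, ← add_div, Set.union_inter_distrib_right, Set.ncard_union_eq
    (h.mono Set.inter_subset_left Set.inter_subset_left)
    ((Set.finite_Icc 1 n).inter_of_right K) ((Set.finite_Icc 1 n).inter_of_right K')]
  push_cast
  rfl

theorem isBoundedUnder_ratio (K : Set ℕ) : IsBoundedUnder (· ≤ ·) atTop (ratio K) :=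
  isBoundedUnder_of ⟨1, ratio_le_one K⟩

theorem isCoboundedUnder_ratio (K : Set ℕ) : IsCoboundedUnder (· ≤ ·) atTop (ratio K) :=
  (isBoundedUnder_of ⟨0, ratio_nonneg K⟩ : IsBoundedUnder (· ≥ ·) atTop (ratio K)).isCoboundedUnder_le

theorem upperDensity_eq_limsup (K : Set ℕ) : upperDensity K = limsup (ratio K) atTop := rfl

theorem upperDensity_le_of_eventually {K : Set ℕ} {c : ℝ}
    (h : ∀ ε > 0, ∀ᶠ n in atTop, ratio K n ≤ c + ε) : upperDensity K ≤ c :=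
  le_of_forall_pos_le_add fun ε hε => limsup_le_of_le (isCoboundedUnder_ratio K) (h ε hε)

theorem le_upperDensity_of_eventually {K : Set ℕ} {c : ℝ}
    (h : ∀ᶠ n in atTop, c ≤ ratio K n) : c ≤ upperDensity K :=
  le_limsup_of_frequently_le h.frequently (isBoundedUnder_ratio K)

theorem HasDensity.upperDensity_eq {K : Set ℕ} {d : ℝ} (h : HasDensity K d) : upperDensity K = d :=
  Tendsto.limsup_eq h

theorem HasDensity.compl {K : Set ℕ} {d : ℝ} (h : HasDensity K d) : HasDensity Kᶜ (1 - d) := by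
  refine (h.const_sub 1).congr' ?_
  filter_upwards [eventually_gt_atTop 0] with n hn
  linarith [ratio_add_ratio_compl K hn]

theorem HasDensity.union {K K' : Set ℕ} {d d' : ℝ} (h : HasDensity K d) (h' : HasDensity K' d')
    (hd : Disjoint K K') : HasDensity (K ∪ K') (d + d') :=
  (h.add h').congr fun n => (ratio_union_of_disjoint hd n).symm

/-- The upper density does not see finitely many elements. -/
theorem upperDensity_mono_of_eventually {K K' : Set ℕ} (h : ∀ᶠ n in atTop, n ∈ K → n ∈ K') :
    upperDensity K ≤ upperDensity K' := by
  obtain ⟨N, hN⟩ := eventually_atTop.mp h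
  refine upperDensity_le_of_eventually fun ε hε => ?_
  have h1 : ∀ᶠ n in atTop, ratio K' n < upperDensity K' + ε / 2 :=
    eventually_lt_of_limsup_lt (by rw [← upperDensity_eq_limsup]; linarith)
      (isBoundedUnder_ratio K')
  have h2 := (tendsto_const_div_atTop_nhds_zero_nat (N : ℝ)).eventually_lt_const
    (show 0 < ε / 2 by positivity)
  filter_upwards [h1, h2] with n hn1 hn2
  have h3 : ((K ∩ Set.Icc 1 n).ncard : ℝ) ≤ (K' ∩ Set.Icc 1 n).ncard + N := by
    have hsub : K ∩ Set.Icc 1 n ⊆ (K' ∩ Set.Icc 1 n) ∪ Set.Iio N := by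
      rintro k ⟨hk, hkn⟩
      rcases lt_or_ge k N with hlt | hge
      · exact Or.inr hlt
      · exact Or.inl ⟨hN k hge hk, hkn⟩
    have h4 := (Set.ncard_le_ncard hsub (((Set.finite_Icc 1 n).inter_of_right K').union
      (Set.finite_Iio N))).trans (Set.ncard_union_le _ _)
    have h5 : (Set.Iio N).ncard = N := by
      rw [Set.ncard_eq_toFinset_card']; simp
    rw [h5] at h4
    exact_mod_cast h4
  have h4 : ratio K n ≤ ratio K' n + N / n := by
    rw [ratio, ratio, ← add_div]
    gcongr
  linarith

/-- The index of convergence of a sequence asymptotic to a sequence with finitely many values. -/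
theorem index_eq_of_finite_range {u v : ℕ → ℝ} (huv : Tendsto (fun n => u n - v n) atTop (𝓝 0))
    (hv : (Set.range v).Finite) {L d : ℝ} (hd : HasDensity {n | v n = L} d) :
    index u L = d := by
  have hcompl : upperDensity {n | v n = L}ᶜ = 1 - d := hd.compl.upperDensity_eq
  -- The other values of `v` form a finite set, so they stay at a distance at least `r` from `L`;
  -- then `ε = r/2` already realizes the supremum.
  have hnhds : (Set.range v \ {L})ᶜ ∈ 𝓝 L :=
    (hv.subset Set.sdiff_subset).isClosed.isOpen_compl.mem_nhds (by simp)
  obtain ⟨r, hr, hball⟩ := Metric.mem_nhds_iff.mp hnhds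
  have hsep : ∀ n, v n ≠ L → r ≤ |v n - L| := by
    intro n hn
    by_contra! hlt
    exact hball (by rwa [Metric.mem_ball, Real.dist_eq]) ⟨⟨n, rfl⟩, hn⟩
  rw [Metric.tendsto_atTop'] at huv
  have hle : ∀ ε : {ε : ℝ // 0 < ε},
      upperDensity {n | u n ∈ Set.Iic (L - (ε : ℝ)) ∪ Set.Ici (L + (ε : ℝ))} ≤ 1 - d := by
    rintro ⟨ε, hε⟩
    rw [← hcompl]
    obtain ⟨N, hN⟩ := huv ε hε
    refine upperDensity_mono_of_eventually ?_
    filter_upwards [eventually_gt_atTop N] with n hn hmem hvn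
    have h1 := hN n hn
    rw [Set.mem_ofPred_eq] at hvn
    rw [Real.dist_eq, sub_zero, hvn, abs_lt] at h1
    rcases hmem with hmem | hmem
    · rw [Set.mem_Iic] at hmem; linarith
    · rw [Set.mem_Ici] at hmem; linarith
  have : Nonempty {ε : ℝ // 0 < ε} := ⟨⟨1, one_pos⟩⟩
  rw [index, sub_eq_iff_eq_add, ← sub_eq_iff_eq_add']
  refine (le_antisymm (ciSup_le hle) ?_).symm
  refine le_trans ?_ (le_ciSup (f := fun ε : {ε : ℝ // 0 < ε} =>
    upperDensity {n | u n ∈ Set.Iic (L - (ε : ℝ)) ∪ Set.Ici (L + (ε : ℝ))})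
    ⟨1 - d, by rintro _ ⟨ε, rfl⟩; exact hle ε⟩ ⟨r / 2, by positivity⟩)
  rw [← hcompl]
  obtain ⟨N, hN⟩ := huv (r / 2) (by positivity)
  refine upperDensity_mono_of_eventually ?_
  filter_upwards [eventually_gt_atTop N] with n hn hvn
  have h1 := hN n hn
  rw [Real.dist_eq, sub_zero, abs_lt] at h1
  have h2 := hsep n hvn
  rcases le_abs.mp h2 with h2 | h2
  · right
    rw [Set.mem_Ici]; linarith
  · left
    rw [Set.mem_Iic]; linarith

/-- The count up to `n` is a difference of two floors and differs from `n/q` by at most `1`. -/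
theorem hasDensity_modEq {q : ℕ} (hq : 0 < q) (r : ℕ) :
    HasDensity {n | n ≡ r [MOD q]} (1 / q) := by
  have hq' : (0 : ℝ) < q := by exact_mod_cast hq
  have key : ∀ n : ℕ, |(({n | n ≡ r [MOD q]} ∩ Set.Icc 1 n).ncard : ℝ) - n / q| ≤ 1 := by
    intro n
    have h1 : ({n | n ≡ r [MOD q]} ∩ Set.Icc 1 n).ncard =
        ((Finset.Ioc 0 n).filter (· ≡ r [MOD q])).card := by
      rw [← Set.ncard_coe_finset]
      congr 1
      ext k
      simp [Nat.succ_le_iff, and_comm]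
    have h2 := Nat.Ioc_filter_modEq_card 0 n hq r
    have h3 : ⌊(((0 : ℕ) : ℚ) - r) / q⌋ ≤ ⌊((n : ℚ) - r) / q⌋ := by
      apply Int.floor_le_floor
      gcongr
      simp
    rw [max_eq_left (sub_nonneg.mpr h3)] at h2
    have h4 : ((({n | n ≡ r [MOD q]} ∩ Set.Icc 1 n).ncard : ℕ) : ℚ) =
        (⌊((n : ℚ) - r) / q⌋ : ℚ) - (⌊(((0 : ℕ) : ℚ) - r) / q⌋ : ℚ) := by
      rw [h1]; exact_mod_cast h2
    have h5 : |((({n | n ≡ r [MOD q]} ∩ Set.Icc 1 n).ncard : ℕ) : ℚ) - n / q| ≤ 1 := by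
      rw [h4, abs_le]
      have a1 := Int.floor_le (((n : ℚ) - r) / q)
      have a2 := Int.lt_floor_add_one (((n : ℚ) - r) / q)
      have a3 := Int.floor_le ((((0 : ℕ) : ℚ) - r) / q)
      have a4 := Int.lt_floor_add_one ((((0 : ℕ) : ℚ) - r) / q)
      have a5 : ((n : ℚ) - r) / q = n / q + (((0 : ℕ) : ℚ) - r) / q := by push_cast; ring
      constructor <;> linarith
    have h6 := (Rat.cast_le (K := ℝ)).mpr h5
    push_cast at h6
    exact h6
  rw [HasDensity, ← tendsto_sub_nhds_zero_iff]
  refine squeeze_zero_norm' ?_ (tendsto_const_div_atTop_nhds_zero_nat (1 : ℝ))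
  filter_upwards [eventually_gt_atTop 0] with n hn
  have hn' : (0 : ℝ) < n := by exact_mod_cast hn
  have e : ratio {n | n ≡ r [MOD q]} n - 1 / q =
      ((({n | n ≡ r [MOD q]} ∩ Set.Icc 1 n).ncard : ℝ) - n / q) / n := by
    rw [ratio]; field_simp
  rw [e, norm_div, Real.norm_eq_abs, Real.norm_eq_abs, abs_of_pos hn']
  gcongr
  exact key n

/-- As `p` is invertible modulo `q`, the condition singles out one residue class of `n`. -/
theorem hasDensity_mul_add_mod {p q : ℕ} (hq : 0 < q) (hpq : Nat.gcd p q = 1) (s : ℕ) {m : ℕ}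
    (hm : m < q) : HasDensity {n | (n * p + s) % q = m} (1 / q) := by
  have : NeZero q := ⟨hq.ne'⟩
  have hp : (p : ZMod q) * (p : ZMod q)⁻¹ = 1 := ZMod.coe_mul_inv_eq_one p hpq
  set r : ZMod q := ((m : ZMod q) - s) * (p : ZMod q)⁻¹ with hr
  have h : {n | (n * p + s) % q = m} = {n | n ≡ r.val [MOD q]} := by
    ext n
    have h1 : (n * p + s) % q = m ↔ ((n * p + s : ℕ) : ZMod q) = m := by
      rw [ZMod.natCast_eq_natCast_iff, Nat.ModEq, Nat.mod_eq_of_lt hm]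
    rw [Set.mem_ofPred_eq, Set.mem_ofPred_eq, h1, ← ZMod.natCast_eq_natCast_iff, ZMod.natCast_val,
      ZMod.cast_id', id, hr]
    push_cast
    constructor
    · intro h
      rw [← h, add_sub_cancel_right, mul_assoc, hp, mul_one]
    · intro h
      rw [h, mul_assoc, mul_comm (p : ZMod q)⁻¹, hp, mul_one, sub_add_cancel]
  rw [h]
  exact hasDensity_modEq hq _

/-! ### Rational angles -/

section
variable {p q : ℕ} {θ : ℝ}

/-- The position is `(np + q/2)/q`, with a true half. Splitting `q/2` into its integer quotient and
`(q % 2)/2` treats both parities at once: the fractional parts are `m/q` for even `q` and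
`(2m+1)/(2q)` for odd `q`. -/
theorem posFract_of_rational (hq : 0 < q) (h : θ / Real.pi = (p : ℝ) / q) (n : ℕ) :
    posFract n θ = (((n * p + q / 2) % q : ℕ) + ((q % 2 : ℕ) : ℝ) / 2) / q := by
  have hq' : (0 : ℝ) < q := by exact_mod_cast hq
  have h1 : (q : ℝ) = 2 * (q / 2 : ℕ) + (q % 2 : ℕ) := by
    exact_mod_cast (Nat.div_add_mod q 2).symm
  have h2 : ((n * p + q / 2 : ℕ) : ℝ) =
      q * ((n * p + q / 2) / q : ℕ) + ((n * p + q / 2) % q : ℕ) := by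
    exact_mod_cast (Nat.div_add_mod (n * p + q / 2) q).symm
  have h3 : ((n * p + q / 2) % q : ℕ) + 1 ≤ q := Nat.mod_lt _ hq
  have h4 : (((n * p + q / 2) % q : ℕ) : ℝ) + 1 ≤ q := by exact_mod_cast h3
  have h5 : ((q % 2 : ℕ) : ℝ) ≤ 1 := by
    exact_mod_cast (by omega : q % 2 ≤ 1)
  rw [posFract, Int.fract_eq_iff]
  refine ⟨by positivity, ?_, (((n * p + q / 2) / q : ℕ) : ℤ), ?_⟩
  · rw [div_lt_one hq']
    linarith
  · rw [pos, mul_div_assoc, h, Int.cast_natCast]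
    push_cast at h2
    field_simp
    linarith

theorem finite_range_jumpValue (hq : 0 < q) (h : θ / Real.pi = (p : ℝ) / q) (a b d : ℝ) :
    (Set.range (jumpValue a b d θ)).Finite := by
  refine ((Finset.range q).finite_toSet.image fun k : ℕ =>
    if ((k : ℝ) + ((q % 2 : ℕ) : ℝ) / 2) / q = 0 then d else
      gJump a b (((k : ℝ) + ((q % 2 : ℕ) : ℝ) / 2) / q)).subset ?_
  rintro _ ⟨n, rfl⟩
  refine ⟨(n * p + q / 2) % q, by simpa using Nat.mod_lt _ hq, ?_⟩
  rw [jumpValue, posFract_of_rational hq h]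

/-- For odd `q` the fractional part never vanishes: the point is never a node and `d` never appears.
-/
theorem index_of_odd {u : ℕ → ℝ} {a b d : ℝ} (hab : a ≠ b) (hq : Odd q)
    (hpq : Nat.gcd p q = 1) (h : θ / Real.pi = (p : ℝ) / q)
    (hu : Tendsto (fun n => u n - jumpValue a b d θ n) atTop (𝓝 0)) {m : ℕ} (hm : m < q) :
    index u (gJump a b ((2 * (m : ℝ) + 1) / (2 * q))) = 1 / q := by
  have hq0 : 0 < q := hq.pos
  have hq' : (0 : ℝ) < q := by exact_mod_cast hq0
  have hfr : ∀ n, posFract n θ = (2 * (((n * p + q / 2) % q : ℕ) : ℝ) + 1) / (2 * q) := by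
    intro n
    rw [posFract_of_rational hq0 h, Nat.odd_iff.mp hq]
    field_simp
    push_cast
    ring
  have hmem : ∀ k : ℕ, k < q → (2 * (k : ℝ) + 1) / (2 * q) ∈ Set.Ioo (0 : ℝ) 1 := by
    intro k hk
    have : (k : ℝ) + 1 ≤ q := by exact_mod_cast hk
    refine ⟨by positivity, ?_⟩
    rw [div_lt_one (by positivity)]
    linarith
  refine index_eq_of_finite_range hu (finite_range_jumpValue hq0 h a b d) ?_
  convert hasDensity_mul_add_mod hq0 hpq (q / 2) hm using 1
  ext n
  have hk := Nat.mod_lt (n * p + q / 2) hq0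
  rw [Set.mem_ofPred_eq, Set.mem_ofPred_eq, jumpValue, if_neg (by rw [hfr]; exact (hmem _ hk).1.ne'),
    (gJump_injOn hab).eq_iff (by rw [hfr]; exact hmem _ hk) (hmem m hm), hfr,
    div_left_inj' (by positivity)]
  constructor
  · intro h
    have : (((n * p + q / 2) % q : ℕ) : ℝ) = m := by linarith
    exact_mod_cast this
  · rintro rfl
    rfl

theorem posFract_of_even (hq0 : 0 < q) (hq : Even q) (h : θ / Real.pi = (p : ℝ) / q) (n : ℕ) :
    posFract n θ = (((n * p + q / 2) % q : ℕ) : ℝ) / q := by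
  rw [posFract_of_rational hq0 h, Nat.even_iff.mp hq]
  simp

theorem div_mem_Ioo {k : ℕ} (hk : 1 ≤ k) (hkq : k < q) : (k : ℝ) / q ∈ Set.Ioo (0 : ℝ) 1 := by
  have h1 : (0 : ℝ) < k := by exact_mod_cast hk
  have h2 : (k : ℝ) < q := by exact_mod_cast hkq
  exact ⟨div_pos h1 (h1.trans h2), (div_lt_one (h1.trans h2)).mpr h2⟩

theorem jumpValue_of_even (hq0 : 0 < q) (hq : Even q) (h : θ / Real.pi = (p : ℝ) / q) (a b d : ℝ)
    (n : ℕ) : jumpValue a b d θ n = if (n * p + q / 2) % q = 0 then d else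
      gJump a b ((((n * p + q / 2) % q : ℕ) : ℝ) / q) := by
  have hq' : (q : ℝ) ≠ 0 := by exact_mod_cast hq0.ne'
  rw [jumpValue, posFract_of_even hq0 hq h]
  congr 1
  rw [div_eq_zero_iff, or_iff_left hq', Nat.cast_eq_zero]

theorem gJump_div_eq_iff {a b : ℝ} (hab : a ≠ b) {k m : ℕ} (hk : 1 ≤ k) (hkq : k < q) (hm : 1 ≤ m)
    (hmq : m < q) : gJump a b ((k : ℝ) / q) = gJump a b ((m : ℝ) / q) ↔ k = m := by
  have hq' : (q : ℝ) ≠ 0 := by exact_mod_cast (by omega : q ≠ 0)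
  rw [(gJump_injOn hab).eq_iff (div_mem_Ioo hk hkq) (div_mem_Ioo hm hmq), div_left_inj' hq',
    Nat.cast_inj]

theorem index_of_even {u : ℕ → ℝ} {a b d : ℝ} (hab : a ≠ b) (hq0 : 0 < q) (hq : Even q)
    (hpq : Nat.gcd p q = 1) (h : θ / Real.pi = (p : ℝ) / q)
    (hu : Tendsto (fun n => u n - jumpValue a b d θ n) atTop (𝓝 0)) {m : ℕ} (hm : 1 ≤ m)
    (hmq : m < q) (hd : gJump a b ((m : ℝ) / q) ≠ d) :
    index u (gJump a b ((m : ℝ) / q)) = 1 / q := by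
  refine index_eq_of_finite_range hu (finite_range_jumpValue hq0 h a b d) ?_
  convert hasDensity_mul_add_mod hq0 hpq (q / 2) hmq using 1
  ext n
  have hk := Nat.mod_lt (n * p + q / 2) hq0
  rw [Set.mem_ofPred_eq, Set.mem_ofPred_eq, jumpValue_of_even hq0 hq h]
  split_ifs with h0
  · rw [h0]
    exact iff_of_false hd.symm (by omega)
  · exact gJump_div_eq_iff hab (Nat.one_le_iff_ne_zero.mpr h0) hk hm hmq

theorem index_of_even_of_forall_ne {u : ℕ → ℝ} {a b d : ℝ} (hq0 : 0 < q)
    (hq : Even q) (hpq : Nat.gcd p q = 1) (h : θ / Real.pi = (p : ℝ) / q)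
    (hu : Tendsto (fun n => u n - jumpValue a b d θ n) atTop (𝓝 0))
    (hd : ∀ m : ℕ, 1 ≤ m → m < q → gJump a b ((m : ℝ) / q) ≠ d) : index u d = 1 / q := by
  refine index_eq_of_finite_range hu (finite_range_jumpValue hq0 h a b d) ?_
  convert hasDensity_mul_add_mod hq0 hpq (q / 2) hq0 using 1
  ext n
  have hk := Nat.mod_lt (n * p + q / 2) hq0
  rw [Set.mem_ofPred_eq, Set.mem_ofPred_eq, jumpValue_of_even hq0 hq h]
  split_ifs with h0
  · simp [h0]
  · exact iff_of_false (hd _ (Nat.one_le_iff_ne_zero.mpr h0) hk) h0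

/-- Two disjoint residue classes lead to the value `d`: the rows having the point as a node, and
those with fractional part `m/q`. Injectivity of `gJump a b` excludes a third. -/
theorem index_of_even_of_eq {u : ℕ → ℝ} {a b d : ℝ} (hab : a ≠ b) (hq0 : 0 < q)
    (hq : Even q) (hpq : Nat.gcd p q = 1) (h : θ / Real.pi = (p : ℝ) / q)
    (hu : Tendsto (fun n => u n - jumpValue a b d θ n) atTop (𝓝 0)) {m : ℕ} (hm : 1 ≤ m)
    (hmq : m < q) (hd : gJump a b ((m : ℝ) / q) = d) : index u d = 2 / q := by
  refine index_eq_of_finite_range hu (finite_range_jumpValue hq0 h a b d) ?_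
  rw [show (2 : ℝ) / q = 1 / q + 1 / q by ring]
  convert (hasDensity_mul_add_mod hq0 hpq (q / 2) hq0).union
    (hasDensity_mul_add_mod hq0 hpq (q / 2) hmq) ?_ using 1
  · ext n
    have hk := Nat.mod_lt (n * p + q / 2) hq0
    rw [Set.mem_ofPred_eq, Set.mem_union, Set.mem_ofPred_eq, Set.mem_ofPred_eq,
      jumpValue_of_even hq0 hq h]
    split_ifs with h0
    · simp [h0]
    · rw [← hd, gJump_div_eq_iff hab (Nat.one_le_iff_ne_zero.mpr h0) hk hm hmq]
      simp [h0]
  · rw [Set.disjoint_left]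
    intro n h1 h2
    rw [Set.mem_ofPred_eq] at h1 h2
    omega

end

/-! ### Equidistribution -/

/-- The averages of a function over the first terms of an arithmetic progression modulo one. -/
def circleAverage (f : UnitAddCircle → ℂ) (α c : ℝ) (N : ℕ) : ℂ :=
  (∑ k ∈ Finset.Icc 1 N, f ((k * α + c : ℝ) : UnitAddCircle)) / N

section
variable {α : ℝ}

/-- For `m ≠ 0` the sum is geometric with ratio `r = exp(2πimα)`, different from `1` by
irrationality; it stays bounded by `2/‖r - 1‖`, so the averages tend to `0`. -/
theorem tendsto_circleAverage_fourier (hα : Irrational α) (c : ℝ) (m : ℤ) :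
    Tendsto (circleAverage (fourier m) α c) atTop
      (𝓝 (∫ z : UnitAddCircle, (fourier m z : ℂ))) := by
  rcases eq_or_ne m 0 with rfl | hm
  · have h1 : ∫ z : UnitAddCircle, (fourier 0 z : ℂ) = 1 := by
      simp [measureReal_def]
    rw [h1]
    refine tendsto_const_nhds.congr' ?_
    filter_upwards [eventually_gt_atTop 0] with N hN
    have : (N : ℂ) ≠ 0 := by exact_mod_cast hN.ne'
    simp [circleAverage, this]
  · have h1 : ∫ z : UnitAddCircle, (fourier m z : ℂ) = 0 :=
      integral_eq_zero_of_add_right_eq_neg (fourier_add_half_inv_index hm one_pos)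
    rw [h1]
    set r : ℂ := fourier m (α : UnitAddCircle) with hr
    have hr1 : r ≠ 1 := by
      rw [hr, fourier_coe_apply, Ne, Complex.exp_eq_one_iff]
      rintro ⟨k, hk⟩
      have hpi : (2 * Real.pi * Complex.I : ℂ) ≠ 0 := Complex.two_pi_I_ne_zero
      have h2 : (m : ℂ) * α = k := by
        apply mul_left_cancel₀ hpi
        rw [Complex.ofReal_one, div_one] at hk
        rw [mul_comm _ (k : ℂ), ← hk]
        ring
      have h3 : (m : ℝ) * α = k := by exact_mod_cast h2
      exact (hα.intCast_mul hm).ne_int k h3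
    have hterm : ∀ k : ℕ, (fourier m ((k * α + c : ℝ) : UnitAddCircle) : ℂ) =
        fourier m (c : UnitAddCircle) * r ^ k := by
      intro k
      rw [hr, fourier_coe_apply, fourier_coe_apply, fourier_coe_apply, ← Complex.exp_nat_mul,
        ← Complex.exp_add]
      congr 1
      push_cast
      ring
    have hnorm : ‖r‖ = 1 := Circle.norm_coe _
    have hnormc : ‖(fourier m (c : UnitAddCircle) : ℂ)‖ = 1 := Circle.norm_coe _
    have hbound : ∀ N : ℕ, ‖∑ k ∈ Finset.Icc 1 N,
        (fourier m ((k * α + c : ℝ) : UnitAddCircle) : ℂ)‖ ≤ 2 / ‖r - 1‖ := by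
      intro N
      simp_rw [hterm]
      rw [← Finset.mul_sum, norm_mul, hnormc, one_mul, ← Finset.Ico_add_one_right_eq_Icc,
        geom_sum_Ico hr1 (by omega), norm_div]
      gcongr
      refine (norm_sub_le _ _).trans ?_
      rw [norm_pow, norm_pow, hnorm, one_pow, one_pow]
      norm_num
    refine squeeze_zero_norm (fun N => ?_) (tendsto_const_div_atTop_nhds_zero_nat (2 / ‖r - 1‖))
    rw [circleAverage, norm_div, Complex.norm_natCast]
    gcongr
    exact hbound N

/-- Weyl's equidistribution theorem. -/
theorem tendsto_circleAverage (hα : Irrational α) (c : ℝ) (f : C(UnitAddCircle, ℂ)) :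
    Tendsto (circleAverage f α c) atTop (𝓝 (∫ z : UnitAddCircle, f z)) := by
  have hint : ∀ g : C(UnitAddCircle, ℂ), Integrable g (volume : Measure UnitAddCircle) := fun g =>
    g.continuous.integrable_of_hasCompactSupport (HasCompactSupport.of_compactSpace g)
  have hspan : ∀ g ∈ Submodule.span ℂ (Set.range (@fourier (1 : ℝ))),
      Tendsto (circleAverage g α c) atTop (𝓝 (∫ z : UnitAddCircle, g z)) := by
    intro g hg
    induction hg using Submodule.span_induction with
    | mem g hg =>
      obtain ⟨m, rfl⟩ := hg
      exact tendsto_circleAverage_fourier hα c m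
    | zero =>
      have h0 : circleAverage (0 : UnitAddCircle → ℂ) α c = fun _ => 0 := by
        ext N
        simp [circleAverage]
      simp [h0]
    | add g h _ _ hg hh =>
      have := hg.add hh
      simp only [ContinuousMap.add_apply]
      rw [integral_add (hint g) (hint h)]
      refine this.congr fun N => ?_
      simp [circleAverage, Finset.sum_add_distrib, add_div]
    | smul a g _ hg =>
      have := hg.const_mul a
      simp only [ContinuousMap.smul_apply, smul_eq_mul]
      rw [integral_const_mul]
      refine this.congr fun N => ?_
      rw [circleAverage, circleAverage, mul_div_assoc', Finset.mul_sum]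
      rfl
  rw [Metric.tendsto_atTop]
  intro ε hε
  -- Trigonometric polynomials are uniformly dense, and averages and integral are both 1-Lipschitz
  -- for the uniform norm.
  have hf : f ∈ (Submodule.span ℂ (Set.range (@fourier (1 : ℝ)))).topologicalClosure := by
    rw [span_fourier_closure_eq_top]
    trivial
  obtain ⟨g, hg, hfg⟩ := Metric.mem_closure_iff.mp hf (ε / 3) (by positivity)
  obtain ⟨N₀, hN₀⟩ := Metric.tendsto_atTop.mp (hspan g hg) (ε / 3) (by positivity)
  have hpt : ∀ z, ‖f z - g z‖ ≤ ε / 3 := fun z => by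
    rw [← dist_eq_norm]
    exact (ContinuousMap.dist_apply_le_dist z).trans hfg.le
  refine ⟨N₀, fun N hN => ?_⟩
  have h1 : ‖circleAverage f α c N - circleAverage g α c N‖ ≤ ε / 3 := by
    rw [circleAverage, circleAverage, ← sub_div, ← Finset.sum_sub_distrib, norm_div,
      Complex.norm_natCast]
    refine div_le_of_le_mul₀ N.cast_nonneg (by positivity) ?_
    refine (norm_sum_le _ _).trans ((Finset.sum_le_sum fun k _ => hpt _).trans_eq ?_)
    simp [mul_comm]
  have h2 : ‖∫ z : UnitAddCircle, f z - g z‖ ≤ ε / 3 := by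
    refine (norm_integral_le_of_norm_le_const (Eventually.of_forall hpt)).trans_eq ?_
    rw [measureReal_def, UnitAddCircle.measure_univ, ENNReal.toReal_one, mul_one]
  rw [integral_sub (hint f) (hint g)] at h2
  have h3 := hN₀ N hN
  rw [dist_eq_norm] at h3 ⊢
  calc _ = ‖(circleAverage f α c N - circleAverage g α c N) +
        (circleAverage g α c N - ∫ z : UnitAddCircle, g z) -
        ((∫ z : UnitAddCircle, f z) - ∫ z : UnitAddCircle, g z)‖ := by congr 1; ring
    _ ≤ _ := (norm_sub_le _ _).trans (add_le_add_left (norm_add_le _ _) _)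
    _ < ε := by linarith

theorem ratio_eq_sum_indicator (K : Set ℕ) (n : ℕ) :
    ratio K n = (∑ k ∈ Finset.Icc 1 n, K.indicator (fun _ => (1 : ℝ)) k) / n := by
  classical
  rw [ratio]
  congr 1
  have h : K ∩ Set.Icc 1 n = ((Finset.Icc 1 n).filter (· ∈ K) : Finset ℕ) := by
    ext k
    simp only [Set.mem_inter_iff, Set.mem_Icc, Finset.coe_filter, Finset.mem_Icc,
      Set.mem_ofPred_eq]
    exact and_comm
  rw [h, Set.ncard_coe_finset, Finset.card_filter]
  push_cast
  exact Finset.sum_congr rfl fun k _ => by simp [Set.indicator_apply]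

/-- An arithmetic progression modulo one visits an open set with at least the expected frequency. -/
theorem eventually_le_ratio_fract_mem (hα : Irrational α) (c : ℝ) {G : Set ℝ} (hG : IsOpen G)
    (hG1 : G ⊆ Set.Ioo 0 1) {b : ℝ} (hb : b < volume.real G) :
    ∀ᶠ N in atTop, b ≤ ratio {k | Int.fract (k * α + c) ∈ G} N := by
  set U : Set UnitAddCircle := (fun x : ℝ => (x : UnitAddCircle)) '' G with hU
  have hUo : IsOpen U := QuotientAddGroup.isOpenMap_coe G hG
  have hmem : ∀ x : ℝ, (x : UnitAddCircle) ∈ U → Int.fract x ∈ G := by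
    rintro x ⟨y, hy, hyx⟩
    have h1 : Int.fract y = Int.fract x := by
      have h2 := congrArg (fun z : UnitAddCircle => (AddCircle.equivIco 1 0 z : ℝ)) hyx
      simpa [AddCircle.coe_equivIco_mk_apply] using h2
    rw [← h1, Int.fract_eq_self.mpr ⟨(hG1 hy).1.le, (hG1 hy).2⟩]
    exact hy
  have hvol : volume.real U = volume.real G := by
    have h1 := (UnitAddCircle.measurePreserving_mk 0).measure_preimage
      hUo.measurableSet.nullMeasurableSet
    rw [measureReal_def, measureReal_def, ← h1, Measure.restrict_apply
      (hUo.measurableSet.preimage (UnitAddCircle.measurePreserving_mk 0).measurable)]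
    congr 2
    ext x
    constructor
    · rintro ⟨hx, hx0, hx1⟩
      have h2 := hmem x hx
      rw [zero_add] at hx1
      -- The circle is parametrized by `]0,1]`; the endpoint `1` has fractional part `0`, which is
      -- not in `G`.
      rcases hx1.eq_or_lt with rfl | hx1
      · rw [Int.fract_one] at h2
        exact absurd (hG1 h2).1 (lt_irrefl _)
      · rwa [Int.fract_eq_self.mpr ⟨hx0.le, hx1⟩] at h2
    · intro hx
      exact ⟨⟨x, hx, rfl⟩, (hG1 hx).1, by linarith [(hG1 hx).2]⟩
  rcases lt_or_ge b 0 with hb0 | hb0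
  · exact Eventually.of_forall fun N => hb0.le.trans (ratio_nonneg _ N)
  rw [← hvol] at hb
  have hb' : ENNReal.ofReal b < volume U := by
    rwa [ENNReal.ofReal_lt_iff_lt_toReal hb0 (measure_ne_top _ _)]
  -- Inner regularity, then a Urysohn function between `K` and `U`: a continuous minorant of the
  -- indicator of `U` whose integral exceeds `b`.
  obtain ⟨K, hKU, hK, hbK⟩ := hUo.exists_lt_isCompact hb'
  obtain ⟨f, hf1, hf0, -, hf⟩ := exists_continuous_one_zero_of_isCompact hK hUo.isClosed_compl
    (Set.disjoint_compl_right_iff_subset.mpr hKU)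
  have hbf : b < ∫ z : UnitAddCircle, f z := by
    have h1 : b < volume.real K := by
      rwa [measureReal_def, ← ENNReal.ofReal_lt_iff_lt_toReal hb0 (measure_ne_top _ _)]
    refine h1.trans_le ?_
    rw [← integral_indicator_one hK.measurableSet]
    refine integral_mono ((integrable_const (1 : ℝ)).indicator hK.measurableSet)
      (f.continuous.integrable_of_hasCompactSupport (HasCompactSupport.of_compactSpace f))
      fun z => ?_
    by_cases hz : z ∈ K
    · rw [Set.indicator_of_mem hz, hf1 hz]
    · rw [Set.indicator_of_notMem hz]
      exact (hf z).1
  have hlim := tendsto_circleAverage hα c ⟨fun z => (f z : ℂ), by fun_prop⟩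
  simp only [ContinuousMap.coe_mk] at hlim
  have hof : ∫ z : UnitAddCircle, (f z : ℂ) = ((∫ z : UnitAddCircle, f z : ℝ) : ℂ) :=
    integral_ofReal
  rw [hof] at hlim
  have hre := (Complex.continuous_re.tendsto _).comp hlim
  rw [Complex.ofReal_re] at hre
  filter_upwards [hre.eventually_const_lt hbf] with N hN
  refine hN.le.trans ?_
  have e : circleAverage (fun z => (f z : ℂ)) α c N =
      (((∑ k ∈ Finset.Icc 1 N, f ((k * α + c : ℝ) : UnitAddCircle)) / N : ℝ) : ℂ) := by
    simp [circleAverage]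
  rw [Function.comp_apply, e, Complex.ofReal_re, ratio_eq_sum_indicator]
  gcongr with k _
  by_cases hk : ((k * α + c : ℝ) : UnitAddCircle) ∈ U
  · rw [Set.indicator_of_mem (show k ∈ {k : ℕ | Int.fract (k * α + c) ∈ G} from hmem _ hk)]
    exact (hf _).2
  · rw [hf0 hk]
    exact Set.indicator_nonneg (fun _ _ => zero_le_one) _

/-- An arithmetic progression modulo one visits a Peano–Jordan measurable set with the expected
frequency. -/
theorem hasDensity_fract_mem (hα : Irrational α) (c : ℝ) {S : Set ℝ} (hS : volume (frontier S) = 0)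
    (hS1 : S ⊆ Set.Ioo 0 1) :
    HasDensity {k | Int.fract (k * α + c) ∈ S} (volume.real S) := by
  have hIoo : volume (Set.Ioo (0 : ℝ) 1) = 1 := by simp
  have hfin : ∀ T : Set ℝ, T ⊆ Set.Ioo 0 1 → volume T ≠ ⊤ := fun T hT =>
    ((measure_mono hT).trans_lt (by rw [hIoo]; exact ENNReal.one_lt_top)).ne
  have hint : volume.real (interior S) = volume.real S := by
    rw [measureReal_def, measureReal_def]
    congr 1
    refine le_antisymm (measure_mono interior_subset) ?_
    calc volume S ≤ volume (interior S ∪ frontier S) := by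
          refine measure_mono (subset_closure.trans ?_)
          rw [closure_eq_interior_union_frontier]
      _ ≤ volume (interior S) + volume (frontier S) := measure_union_le _ _
      _ = volume (interior S) := by rw [hS, add_zero]
  -- The lower bound for open sets is applied twice: to the interior of `S` for the lower limit, and
  -- to `T`, which is the complement of `S` up to a null set, for the upper limit.
  set T := Set.Ioo (0 : ℝ) 1 \ closure S with hT
  have hTo : IsOpen T := isOpen_Ioo.sdiff isClosed_closure
  have hTS : 1 ≤ volume.real T + volume.real S := by
    have h1 : volume (Set.Ioo (0 : ℝ) 1) ≤ volume T + volume S := by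
      calc volume (Set.Ioo (0 : ℝ) 1) ≤ volume ((T ∪ S) ∪ frontier S) := by
            refine measure_mono fun t ht => ?_
            by_cases hc : t ∈ closure S
            · rw [closure_eq_self_union_frontier] at hc
              exact hc.elim (fun h => Or.inl (Or.inr h)) Or.inr
            · exact Or.inl (Or.inl ⟨ht, hc⟩)
        _ ≤ volume (T ∪ S) + volume (frontier S) := measure_union_le _ _
        _ ≤ _ := by rw [hS, add_zero]; exact measure_union_le _ _
    rw [hIoo] at h1
    have h2 := ENNReal.toReal_mono (ENNReal.add_ne_top.mpr
      ⟨hfin T Set.sdiff_subset, hfin S hS1⟩) h1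
    rwa [ENNReal.toReal_one, ENNReal.toReal_add (hfin T Set.sdiff_subset) (hfin S hS1)] at h2
  rw [HasDensity, tendsto_order]
  constructor
  · intro b hb
    obtain ⟨b', hbb', hb'⟩ := exists_between hb
    rw [← hint] at hb'
    filter_upwards [eventually_le_ratio_fract_mem hα c isOpen_interior
      (interior_subset.trans hS1) hb'] with N hN
    have hsub : {k : ℕ | Int.fract (k * α + c) ∈ interior S} ⊆
        {k : ℕ | Int.fract (k * α + c) ∈ S} :=
      fun k hk => (interior_subset : interior S ⊆ S) hk
    exact hbb'.trans_le (hN.trans (ratio_mono hsub N))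
  · intro b hb
    obtain ⟨b', hb', hbb'⟩ := exists_between hb
    filter_upwards [eventually_le_ratio_fract_mem hα c hTo Set.sdiff_subset
      (show 1 - b' < volume.real T by linarith), eventually_gt_atTop 0] with N hN hN0
    have hsub : {k : ℕ | Int.fract (k * α + c) ∈ T} ⊆ {k : ℕ | Int.fract (k * α + c) ∈ S}ᶜ :=
      fun k hk hk' => hk.2 (subset_closure hk')
    have h1 := ratio_mono hsub N
    linarith [ratio_add_ratio_compl {k : ℕ | Int.fract (k * α + c) ∈ S} hN0]

end

/-! ### Irrational angles -/

/-- Inside the interval, continuity sends boundary points of the preimage to boundary points of `A`;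
only the two endpoints can be added. -/
theorem frontier_gJump_preimage_subset (a b : ℝ) (A : Set ℝ) :
    frontier {t ∈ Set.Ioo (0 : ℝ) 1 | gJump a b t ∈ A} ⊆
      {0, 1} ∪ {t ∈ Set.Ioo (0 : ℝ) 1 | gJump a b t ∈ frontier A} := by
  intro t ht
  by_cases ht1 : t ∈ Set.Ioo (0 : ℝ) 1
  · right
    refine ⟨ht1, ?_⟩
    have hnhds : Set.Ioo (0 : ℝ) 1 ∈ 𝓝 t := isOpen_Ioo.mem_nhds ht1
    have hc : ContinuousAt (gJump a b) t := (continuousOn_gJump a b).continuousAt hnhds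
    by_contra hfr
    rw [frontier, Set.mem_sdiff, not_and_not_right] at hfr
    by_cases hcl : gJump a b t ∈ closure A
    · refine ht.2 (mem_interior_iff_mem_nhds.mpr ?_)
      filter_upwards [hnhds, hc (mem_interior_iff_mem_nhds.mp (hfr hcl))] with s hs hs'
      exact ⟨hs, hs'⟩
    · have h1 := hc (isClosed_closure.isOpen_compl.mem_nhds hcl)
      obtain ⟨s, hs, hs'⟩ := mem_closure_iff_nhds.mp ht.1 _ h1
      exact hs (subset_closure hs'.2)
  · left
    have h1 : t ∈ Set.Icc (0 : ℝ) 1 := by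
      rw [← closure_Ioo zero_ne_one]
      exact closure_mono (fun s hs => hs.1) ht.1
    rcases h1.1.eq_or_lt with h | h
    · exact Or.inl h.symm
    · rcases h1.2.eq_or_lt with h' | h'
      · exact Or.inr h'
      · exact absurd ⟨h, h'⟩ ht1

theorem isPeanoJordanMeasurable_gJump_preimage {a b : ℝ} (hab : a ≠ b) {A : Set ℝ}
    (hA : IsPeanoJordanMeasurable A) :
    IsPeanoJordanMeasurable {t ∈ Set.Ioo (0 : ℝ) 1 | gJump a b t ∈ A} := by
  refine measure_mono_null (frontier_gJump_preimage_subset a b A) (measure_union_null ?_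
    (volume_gJump_preimage_eq_zero hab hA))
  exact (Set.toFinite _).measure_zero _

theorem posFract_eq_fract (n : ℕ) (θ : ℝ) :
    posFract n θ = Int.fract (n * (θ / Real.pi) + 1 / 2) := by
  rw [posFract, pos, mul_div_assoc]

theorem posFract_ne_zero_of_irrational {θ : ℝ} (hθ : Irrational (θ / Real.pi)) {n : ℕ}
    (hn : 0 < n) : posFract n θ ≠ 0 := by
  rw [posFract_eq_fract, Ne, Int.fract_eq_zero_iff]
  rintro ⟨k, hk⟩
  have h := (hθ.natCast_mul hn.ne').add_ratCast (1 / 2)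
  push_cast at h
  exact h.ne_int k hk.symm

/-- The index tests neighbourhoods of `A`, so room around `A` is needed. As `δ` decreases to `0`,
the sets of `t` sent outside the closed thickening increase to those sent outside `closure A`; this
union has measure `1 - |g⁻¹(A)|` because the preimage of the frontier is null. -/
theorem exists_lt_volume_gJump_notMem_cthickening {a b : ℝ} (hab : a ≠ b) {A : Set ℝ}
    (hA : IsPeanoJordanMeasurable A) {c : ℝ}
    (hc : c < 1 - volume.real {t ∈ Set.Ioo (0 : ℝ) 1 | gJump a b t ∈ A}) :
    ∃ δ > 0, c < volume.real {t ∈ Set.Ioo (0 : ℝ) 1 | gJump a b t ∉ Metric.cthickening δ A} := by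
  have hIoo : volume (Set.Ioo (0 : ℝ) 1) = 1 := by simp
  have hfin : ∀ T : Set ℝ, T ⊆ Set.Ioo 0 1 → volume T ≠ ⊤ := fun T hT =>
    ((measure_mono hT).trans_lt (by rw [hIoo]; exact ENNReal.one_lt_top)).ne
  rcases lt_or_ge c 0 with hc0 | hc0
  · exact ⟨1, one_pos, hc0.trans_le measureReal_nonneg⟩
  set S := {t ∈ Set.Ioo (0 : ℝ) 1 | gJump a b t ∈ A} with hS
  set G := {t ∈ Set.Ioo (0 : ℝ) 1 | gJump a b t ∉ closure A} with hG
  have hSf := hfin S fun t ht => ht.1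
  have hGf := hfin G fun t ht => ht.1
  have h1 : 1 ≤ volume.real G + volume.real S := by
    have h2 : volume (Set.Ioo (0 : ℝ) 1) ≤ volume G + volume S := by
      calc volume (Set.Ioo (0 : ℝ) 1) ≤
            volume ((G ∪ S) ∪ {t ∈ Set.Ioo (0 : ℝ) 1 | gJump a b t ∈ frontier A}) := by
            refine measure_mono fun t ht => ?_
            by_cases hcl : gJump a b t ∈ closure A
            · have hcl' := hcl
              rw [closure_eq_self_union_frontier] at hcl'
              exact hcl'.elim (fun h => Or.inl (Or.inr ⟨ht, h⟩)) fun h => Or.inr ⟨ht, h⟩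
            · exact Or.inl (Or.inl ⟨ht, hcl⟩)
        _ ≤ volume (G ∪ S) + volume {t ∈ Set.Ioo (0 : ℝ) 1 | gJump a b t ∈ frontier A} :=
            measure_union_le _ _
        _ ≤ _ := by
            rw [volume_gJump_preimage_eq_zero hab hA, add_zero]
            exact measure_union_le _ _
    rw [hIoo] at h2
    have h3 := ENNReal.toReal_mono (ENNReal.add_ne_top.mpr ⟨hGf, hSf⟩) h2
    rwa [ENNReal.toReal_one, ENNReal.toReal_add hGf hSf] at h3
  have hcG : ENNReal.ofReal c < volume G := by
    rw [ENNReal.ofReal_lt_iff_lt_toReal hc0 hGf]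
    exact (by linarith : c < volume.real G)
  set δ : ℕ → ℝ := fun k => 1 / ((k : ℝ) + 1) with hδ
  have hδ0 : ∀ k, 0 < δ k := fun k => by rw [hδ]; positivity
  set H : ℕ → Set ℝ := fun k =>
    {t ∈ Set.Ioo (0 : ℝ) 1 | gJump a b t ∉ Metric.cthickening (δ k) A} with hH
  have hmono : Monotone H := by
    rintro i j hij t ⟨ht, htA⟩
    refine ⟨ht, fun h => htA (Metric.cthickening_mono ?_ A h)⟩
    have : (i : ℝ) ≤ j := by exact_mod_cast hij
    exact one_div_le_one_div_of_le (by positivity) (by linarith)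
  have hunion : ⋃ k, H k = G := by
    ext t
    rw [Set.mem_iUnion]
    constructor
    · rintro ⟨k, ht, htA⟩
      exact ⟨ht, fun h => htA (Metric.closure_subset_cthickening _ _ h)⟩
    · rintro ⟨ht, htA⟩
      by_contra! hk
      refine htA ?_
      rw [Metric.closure_eq_iInter_cthickening]
      refine Set.mem_iInter₂.mpr fun ε hε => ?_
      obtain ⟨k, hkε⟩ := exists_nat_one_div_lt hε
      by_contra hn
      exact hk k ⟨ht, fun h => hn (Metric.cthickening_mono hkε.le A h)⟩
  have hlim := tendsto_measure_iUnion_atTop (μ := volume) hmono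
  rw [hunion] at hlim
  obtain ⟨k, hk⟩ := (hlim.eventually_const_lt hcG).exists
  refine ⟨δ k, hδ0 k, ?_⟩
  rwa [Function.comp_apply, ENNReal.ofReal_lt_iff_lt_toReal hc0 (hfin _ fun t ht => ht.1)] at hk

/-- For every `ε`, rows with `t_n ∈ S` eventually fall in the `ε`-neighbourhood of `A`, so the
exceptional density is at most `1 - |S|`. Conversely, rows with `t_n` sent outside a `δ`-thickening
eventually stay outside the `δ/2`-neighbourhood, and their frequency comes as close to `1 - |S|` as
desired. -/
theorem indexSet_of_irrational {u : ℕ → ℝ} {a b d θ : ℝ} (hab : a ≠ b)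
    (hθ : Irrational (θ / Real.pi))
    (hu : Tendsto (fun n => u n - jumpValue a b d θ n) atTop (𝓝 0)) {A : Set ℝ}
    (hA : IsPeanoJordanMeasurable A) :
    indexSet u A = volume.real {t ∈ Set.Ioo (0 : ℝ) 1 | gJump a b t ∈ A} := by
  set S := {t ∈ Set.Ioo (0 : ℝ) 1 | gJump a b t ∈ A} with hS
  rw [Metric.tendsto_atTop'] at hu
  have hv : ∀ n : ℕ, 0 < n → jumpValue a b d θ n = gJump a b (posFract n θ) := fun n hn =>
    if_neg (posFract_ne_zero_of_irrational hθ hn)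
  have hle : ∀ ε : {ε : ℝ // 0 < ε},
      upperDensity {n | u n ∉ A + Set.Ioo (-(ε : ℝ)) (ε : ℝ)} ≤ 1 - volume.real S := by
    rintro ⟨ε, hε⟩
    have hd := (hasDensity_fract_mem hθ (1 / 2) (isPeanoJordanMeasurable_gJump_preimage hab hA)
      fun t ht => ht.1).compl.upperDensity_eq
    rw [← hd]
    obtain ⟨N, hN⟩ := hu ε hε
    refine upperDensity_mono_of_eventually ?_
    filter_upwards [eventually_gt_atTop N] with n hn hnA hnS
    have h1 := hN n hn
    rw [hv n (by omega), Real.dist_eq, sub_zero, abs_lt] at h1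
    rw [Set.mem_ofPred_eq, ← posFract_eq_fract] at hnS
    exact hnA ⟨_, hnS.2, _, h1, by simp⟩
  have : Nonempty {ε : ℝ // 0 < ε} := ⟨⟨1, one_pos⟩⟩
  rw [indexSet, sub_eq_iff_eq_add, ← sub_eq_iff_eq_add']
  refine (le_antisymm (ciSup_le hle) (le_of_forall_lt fun c hc => ?_)).symm
  obtain ⟨c', hcc', hc'⟩ := exists_between hc
  obtain ⟨δ, hδ, hcδ⟩ := exists_lt_volume_gJump_notMem_cthickening hab hA hc'
  refine lt_of_lt_of_le (hcc'.trans_le ?_) (le_ciSup (f := fun ε : {ε : ℝ // 0 < ε} =>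
    upperDensity {n | u n ∉ A + Set.Ioo (-(ε : ℝ)) (ε : ℝ)})
    ⟨1 - volume.real S, by rintro _ ⟨ε, rfl⟩; exact hle ε⟩ ⟨δ / 2, by positivity⟩)
  have hopen : IsOpen {t ∈ Set.Ioo (0 : ℝ) 1 | gJump a b t ∉ Metric.cthickening δ A} :=
    (continuousOn_gJump a b).isOpen_inter_preimage isOpen_Ioo
      Metric.isClosed_cthickening.isOpen_compl
  refine (le_upperDensity_of_eventually (eventually_le_ratio_fract_mem hθ (1 / 2) hopen
    (fun t ht => ht.1) hcδ)).trans (upperDensity_mono_of_eventually ?_)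
  obtain ⟨N, hN⟩ := hu (δ / 2) (by positivity)
  filter_upwards [eventually_gt_atTop N] with n hn hnG hnA
  rw [← posFract_eq_fract] at hnG
  have h1 := hN n hn
  rw [hv n (by omega), Real.dist_eq, sub_zero, abs_lt] at h1
  -- An error below `δ/2` in the asymptotics and an offset `e` below `δ/2` would place the value of
  -- `gJump a b` within `δ` of `A`.
  obtain ⟨y, hy, e, he, hye⟩ := hnA
  refine hnG.2 (Metric.thickening_subset_cthickening δ A (Metric.mem_thickening_iff.mpr
    ⟨y, hy, ?_⟩))
  simp only at hye
  rw [Real.dist_eq, abs_lt]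
  constructor <;> linarith [he.1, he.2, h1.1, h1.2]

end LagrangeIndex

end

/-! ### The theorem -/

theorem theorem2p2 (f : ℝ → ℝ)
    (hf : BoundedVariationOn f (Set.Icc (-1) 1) ∨ LagrangeIndex.DiniLipschitzPlusSteps f)
    (N : ℕ) (x : Fin N → ℝ) (hx_inj : Function.Injective x)
    (hx : ∀ i, x i ∈ Set.Ioo (-1 : ℝ) 1)
    -- the points `x i` are exactly the points of discontinuity of `f` on `[-1,1]`
    (hdisc : ∀ y ∈ Set.Icc (-1 : ℝ) 1,
      ¬ ContinuousWithinAt f (Set.Icc (-1) 1) y ↔ y ∈ Set.range x)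
    -- the one-sided limits at the points of discontinuity
    (fl fr : Fin N → ℝ)
    (hfl : ∀ i, Tendsto f (𝓝[<] (x i)) (𝓝 (fl i)))
    (hfr : ∀ i, Tendsto f (𝓝[>] (x i)) (𝓝 (fr i)))
    (θ : Fin N → ℝ) (hθ : ∀ i, θ i ∈ Set.Ioo 0 Real.pi) (hxθ : ∀ i, x i = Real.cos (θ i)) :
    (∀ K : Set ℝ, IsCompact K → K ⊆ Set.Ioo (-1) 1 \ Set.range x →
      TendstoUniformlyOn (fun n : ℕ => LagrangeIndex.lagrangeOp n f) f atTop K) ∧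
    ∀ i, fl i ≠ fr i →
      (∀ p q : ℕ, q ≠ 0 → Nat.gcd p q = 1 → θ i / Real.pi = (p : ℝ) / (q : ℝ) →
        (Odd q → ∀ m : ℕ, m < q →
          LagrangeIndex.index (fun n => LagrangeIndex.lagrangeOp n f (x i))
            (LagrangeIndex.gJump (fl i) (fr i) ((2 * (m : ℝ) + 1) / (2 * (q : ℝ))))
            = 1 / (q : ℝ)) ∧
        (Even q →
          ((∀ m : ℕ, 1 ≤ m → m < q →
              LagrangeIndex.gJump (fl i) (fr i) ((m : ℝ) / (q : ℝ)) ≠ f (x i)) →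
            LagrangeIndex.index (fun n => LagrangeIndex.lagrangeOp n f (x i)) (f (x i))
              = 1 / (q : ℝ)) ∧
          (∀ m : ℕ, 1 ≤ m → m < q →
            LagrangeIndex.gJump (fl i) (fr i) ((m : ℝ) / (q : ℝ)) ≠ f (x i) →
            LagrangeIndex.index (fun n => LagrangeIndex.lagrangeOp n f (x i))
              (LagrangeIndex.gJump (fl i) (fr i) ((m : ℝ) / (q : ℝ))) = 1 / (q : ℝ)) ∧
          -- if the value at the point coincides with one of the other limits, both densities add up
          (∀ m : ℕ, 1 ≤ m → m < q →
            LagrangeIndex.gJump (fl i) (fr i) ((m : ℝ) / (q : ℝ)) = f (x i) →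
            LagrangeIndex.index (fun n => LagrangeIndex.lagrangeOp n f (x i)) (f (x i))
              = 2 / (q : ℝ)))) ∧
      (Irrational (θ i / Real.pi) → ∀ A : Set ℝ, LagrangeIndex.IsPeanoJordanMeasurable A →
        LagrangeIndex.IsPeanoJordanMeasurable
          {t ∈ Set.Ioo (0 : ℝ) 1 | LagrangeIndex.gJump (fl i) (fr i) t ∈ A} ∧
        LagrangeIndex.indexSet (fun n => LagrangeIndex.lagrangeOp n f (x i)) A
          = volume.real {t ∈ Set.Ioo (0 : ℝ) 1 | LagrangeIndex.gJump (fl i) (fr i) t ∈ A}) := by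
  have hadm : LagrangeIndex.Admissible f :=
    hf.elim LagrangeIndex.admissible_of_boundedVariationOn
      LagrangeIndex.admissible_of_diniLipschitzPlusSteps
  refine ⟨fun K hK hKx => hadm.tendstoUniformlyOn hK (fun y hy => (hKx hy).1) fun y hy => ?_,
    fun i hi => ?_⟩
  · obtain ⟨hy1, hy2⟩ := hKx hy
    have hcont : ContinuousWithinAt f (Set.Icc (-1) 1) y := by
      by_contra hc
      exact hy2 ((hdisc y (Set.Ioo_subset_Icc_self hy1)).mp hc)
    exact hcont.continuousAt (Icc_mem_nhds hy1.1 hy1.2)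
  · have hu : Tendsto (fun n : ℕ => LagrangeIndex.lagrangeOp n f (x i) -
        LagrangeIndex.jumpValue (fl i) (fr i) (f (x i)) (θ i) n) atTop (𝓝 0) := by
      have h := hadm.tendsto_lagrangeOp_sub_jumpValue (hθ i).1 (hθ i).2
        (by rw [← hxθ i]; exact hfl i) (by rw [← hxθ i]; exact hfr i) hi
      rwa [← hxθ i] at h
    refine ⟨fun p q hq hpq h => ⟨fun hodd m hm => ?_, fun heven => ⟨fun hne => ?_,
      fun m hm hmq hne => ?_, fun m hm hmq heq => ?_⟩⟩, fun hirr A hA => ⟨?_, ?_⟩⟩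
    · exact LagrangeIndex.index_of_odd hi hodd hpq h hu hm
    · exact LagrangeIndex.index_of_even_of_forall_ne (Nat.pos_of_ne_zero hq) heven hpq h hu hne
    · exact LagrangeIndex.index_of_even hi (Nat.pos_of_ne_zero hq) heven hpq h hu hm hmq hne
    · exact LagrangeIndex.index_of_even_of_eq hi (Nat.pos_of_ne_zero hq) heven hpq h hu hm hmq heq
    · exact LagrangeIndex.isPeanoJordanMeasurable_gJump_preimage hi hA
    · exact LagrangeIndex.indexSet_of_irrational hi hirr hu hA
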